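/- Let $a_1,a_2$ be nonzero relatively prime integers such that the ratio of the two complex roots of $X^2-a_1X-a_2$ is not a root of unity, and let $(u_n)_{n\ge 0}$ be the (non-degenerate) Lucas sequence defined by $u_0=0$, $u_1=1$ and $u_n=a_1u_{n-1}+a_2u_{n-2}$ for $n\ge 2$. Then there are a function $\varepsilon:\mathbb R\to\mathbb R$ with $\varepsilon(x)\to 0$ as $x\to\infty$ and a real number $x_0$, both depending only on $a_1$ and $a_2$, such that for all real $x\ge x_0$ and all real $y\ge 1$, $$\#\{n\in\mathbb N:\ 1\le n\le x,\ \gcd(n,u_n)>y\}\ \le\ \frac{x^{\,2-\left(\frac12+\varepsilon(x)\right)\frac{\log\log\log x}{\log\log x}}}{y}.$$ -/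

import Mathlib

/-- The Lucas sequence `u` with `u 0 = 0`, `u 1 = 1` and
`u (n + 2) = a₁ * u (n + 1) + a₂ * u n`. -/
def lucasSeq (a₁ a₂ : ℤ) : ℕ → ℤ
  | 0 => 0
  | 1 => 1
  | n + 2 => a₁ * lucasSeq a₁ a₂ (n + 1) + a₂ * lucasSeq a₁ a₂ n

/-- The coefficients `a₁, a₂` define a non-degenerate Lucas sequence: they are nonzero and
relatively prime, and the ratio of the two complex roots (with multiplicity) of the characteristic
polynomial `X ^ 2 - a₁ X - a₂` is not a root of unity. The roots are nonzero since `a₂ ≠ 0`. -/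
structure IsNondegenerateLucas (a₁ a₂ : ℤ) : Prop where
  left_ne_zero : a₁ ≠ 0
  right_ne_zero : a₂ ≠ 0
  coprime : IsCoprime a₁ a₂
  ratio_not_root_of_unity : ∀ α β : ℂ,
    (Polynomial.X ^ 2 - Polynomial.C (a₁ : ℂ) * Polynomial.X - Polynomial.C (a₂ : ℂ) =
      (Polynomial.X - Polynomial.C α) * (Polynomial.X - Polynomial.C β)) →
    ∀ k : ℕ, 0 < k → (α / β) ^ k ≠ 1

/-- The number of positive integers `n ≤ x` with `gcd (n, u n) > y`. -/
noncomputable def countGcdGt (u : ℕ → ℤ) (x y : ℝ) : ℕ :=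
  {n : ℕ | 0 < n ∧ (n : ℝ) ≤ x ∧ y < (Int.gcd (n : ℤ) (u n) : ℝ)}.ncard

/-!
The theorem follows from Markov's inequality and the bound `x ^ (2 - (1 / 2 - o(1)) r)`, with
`r = log log log x / log log x`, for the sum of `gcd (n, u n)` over `n ≤ x`
(`eventually_lucasGcdSum_le`). Let `z d` be the rank of appearance of `d`, so that `d ∣ u n` if and
only if `z d ∣ n`. With each `n` come `d = gcd (n, u n)`, of rank `k = z d`, and the cofactors
`m = n / d` and `w = n / k`. Fix a small `δ > 0`.

* If `m ≥ x ^ (δ / 4)`, then `d = n / m` is small and the trivial bound is enough.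
* If `m ≤ x ^ (δ / 4)` and `w ≤ x ^ (1 - δ)`, there are few pairs `(m, w)`, and each comes from few
  `d`: the equation `w * z d = m * d` determines the prime factors of `d` up to a finite set
  depending on `u` only (`prime_dvd_of_mul_lucasRank_eq`), and an integer up to `x` with prescribed
  prime factors can be chosen in `x ^ o(1)` ways (`eventually_card_primes_dvd_le`).
* If `w ≥ x ^ (1 - δ)`, then `k ≤ x ^ δ`. For given `m` and `k`, the integer `d` is determined by a
  divisor `f ≤ x / k` of `u k`, and such divisors are counted by Rankin's method with exponent
  `1 - ρ`, where `ρ = (1 / 2 - δ) r`. Every prime `p ∣ u k` has rank `e ∣ k` and, with finitely many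
  exceptions, satisfies `p ≡ ± 1` modulo `e`. Together with the bound `O(e)` for the number of
  prime factors of `u e` this gives `∑ p ^ (ρ - 1) ≪ e ^ (2 ρ - 1) / ρ` over the primes of rank `e`
  (`sum_primesOfRank_rpow_le`). Since `(log x) ^ (2 ρ) = (log log x) ^ (1 - 2 δ)`, the sum of
  `e ^ (2 ρ - 1)` over `e ∣ k` is at most `√(log x)`, by Chebyshev's bound
  (`sum_divisors_rpow_le`). The Rankin sum is therefore `x ^ (o(1) r)`, uniformly in `k`
  (`eventually_sum_divisors_lucasSeq_le`), and the saving is `x ^ ((1 - δ) ρ)`.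
-/

/-! ### Algebra of Lucas sequences -/

section LucasAlgebra

variable {a b : ℤ}

theorem lucasSeq_add_add_one (a b : ℤ) (m n : ℕ) :
    lucasSeq a b (m + n + 1) =
      lucasSeq a b (m + 1) * lucasSeq a b (n + 1) + b * lucasSeq a b m * lucasSeq a b n := by
  induction n generalizing m with
  | zero => simp [lucasSeq]
  | succ n ih =>
    rw [show m + (n + 1) + 1 = (m + 1) + n + 1 by ring, ih (m + 1)]
    simp only [lucasSeq]
    ring

theorem lucasSeq_add (a b : ℤ) (m n : ℕ) :
    lucasSeq a b (m + n) =
      lucasSeq a b m * lucasSeq a b (n + 1) + lucasSeq a b (m + 1) * lucasSeq a b n -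
        a * lucasSeq a b m * lucasSeq a b n := by
  cases n with
  | zero => simp [lucasSeq]
  | succ n =>
    rw [← add_assoc, lucasSeq_add_add_one]
    simp only [lucasSeq]
    ring

theorem lucasSeq_isCoprime_right (hab : IsCoprime a b) (n : ℕ) :
    IsCoprime (lucasSeq a b (n + 1)) b := by
  induction n with
  | zero => simpa [lucasSeq] using isCoprime_one_left
  | succ n ih =>
    simp only [lucasSeq]
    exact (hab.mul_left ih).add_mul_left_left _

theorem lucasSeq_isCoprime_succ (hab : IsCoprime a b) (n : ℕ) :
    IsCoprime (lucasSeq a b (n + 1)) (lucasSeq a b n) := by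
  induction n with
  | zero => simpa [lucasSeq] using isCoprime_one_left
  | succ n ih =>
    have h : IsCoprime (b * lucasSeq a b n) (lucasSeq a b (n + 1)) :=
      (lucasSeq_isCoprime_right hab n).symm.mul_left ih.symm
    have := h.add_mul_right_left a
    simp only [lucasSeq]
    rwa [add_comm]

theorem dvd_lucasSeq_add_iff (hab : IsCoprime a b) {d : ℤ} {m : ℕ} (hd : d ∣ lucasSeq a b m)
    (n : ℕ) : d ∣ lucasSeq a b (m + n) ↔ d ∣ lucasSeq a b n := by
  have hc : IsCoprime d (lucasSeq a b (m + 1)) :=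
    ((lucasSeq_isCoprime_succ hab m).symm).of_isCoprime_of_dvd_left hd
  have h1 : d ∣ lucasSeq a b m * (lucasSeq a b (n + 1) - a * lucasSeq a b n) := hd.mul_right _
  rw [show lucasSeq a b (m + n) = lucasSeq a b (m + 1) * lucasSeq a b n +
      lucasSeq a b m * (lucasSeq a b (n + 1) - a * lucasSeq a b n) by
        rw [lucasSeq_add]; ring, dvd_add_left h1]
  exact ⟨hc.dvd_of_dvd_mul_left, fun h => h.mul_left _⟩

theorem dvd_lucasSeq_mul_add_iff (hab : IsCoprime a b) {d : ℤ} {m : ℕ}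
    (hd : d ∣ lucasSeq a b m) (q n : ℕ) :
    d ∣ lucasSeq a b (m * q + n) ↔ d ∣ lucasSeq a b n := by
  induction q with
  | zero => simp
  | succ q ih =>
    rw [show m * (q + 1) + n = m + (m * q + n) by ring, dvd_lucasSeq_add_iff hab hd, ih]

/-- Modulo `u k ^ 2`, the companion matrix raised to the power `k` is `u (k + 1)` plus a
nilpotent, and its powers expand to first order. The factor `u (k + 1)` on the left of the first
congruence avoids the exponent `j - 1`. -/
theorem lucasSeq_mul_modEq (a b : ℤ) (k j : ℕ) :
    lucasSeq a b k ∣ lucasSeq a b (k * j) ∧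
      lucasSeq a b k ^ 2 ∣
        lucasSeq a b (k * j) * lucasSeq a b (k + 1) -
          j * lucasSeq a b k * lucasSeq a b (k + 1) ^ j ∧
      lucasSeq a b k ^ 2 ∣ lucasSeq a b (k * j + 1) - lucasSeq a b (k + 1) ^ j := by
  induction j with
  | zero => simp [lucasSeq]
  | succ j ih =>
    rw [show k * (j + 1) = k * j + k by ring, lucasSeq_add, lucasSeq_add_add_one]
    obtain ⟨⟨s, hs⟩, ⟨t, ht⟩, ⟨r, hr⟩⟩ := ih
    set u := lucasSeq a b k
    set v := lucasSeq a b (k + 1)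
    refine ⟨⟨s * v + lucasSeq a b (k * j + 1) - a * s * u, by rw [hs]; ring⟩,
      ⟨v * t + v * u * r - a * u * t - a * j * v ^ j, ?_⟩, ⟨v * r + b * s, ?_⟩⟩
    · push_cast
      linear_combination (v - a * u) * ht + u * v * hr
    · linear_combination v * hr + b * u * hs

/-- Lifting the exponent: multiplying the index by `p` gains a factor of `p`. -/
theorem prime_pow_succ_dvd_lucasSeq (hab : IsCoprime a b) {p e k : ℕ}
    (he : 0 < e) (h : ((p ^ e : ℕ) : ℤ) ∣ lucasSeq a b k) :
    ((p ^ (e + 1) : ℕ) : ℤ) ∣ lucasSeq a b (k * p) := by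
  have hpd : (p : ℤ) ∣ lucasSeq a b k :=
    (Int.natCast_dvd_natCast.2 (dvd_pow_self p he.ne')).trans h
  have hc : IsCoprime ((p ^ (e + 1) : ℕ) : ℤ) (lucasSeq a b (k + 1)) := by
    rw [Nat.cast_pow]
    exact (((lucasSeq_isCoprime_succ hab k).symm).of_isCoprime_of_dvd_left hpd).pow_left
  refine hc.dvd_of_dvd_mul_right ?_
  have h2 := (lucasSeq_mul_modEq a b k p).2.1
  have hsq : ((p ^ (e + 1) : ℕ) : ℤ) ∣ lucasSeq a b k ^ 2 := by
    rw [pow_succ, Nat.cast_mul, sq]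
    exact mul_dvd_mul h hpd
  have h3 : ((p ^ (e + 1) : ℕ) : ℤ) ∣
      p * lucasSeq a b k * lucasSeq a b (k + 1) ^ p := by
    rw [pow_succ, Nat.cast_mul, mul_comm ((p ^ e : ℕ) : ℤ)]
    exact (mul_dvd_mul dvd_rfl h).mul_right _
  exact (dvd_sub_left h3).1 (hsq.trans h2)

/-- Binet's formula, without division. -/
theorem sub_mul_lucasSeq {R : Type*} [CommRing R] {α β : R} (hs : α + β = a) (hp : α * β = -b)
    (n : ℕ) : (α - β) * (lucasSeq a b n : R) = α ^ n - β ^ n := by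
  induction n using Nat.twoStepInduction with
  | zero => simp [lucasSeq]
  | one => simp [lucasSeq]
  | more n h1 h2 =>
    simp only [lucasSeq]
    push_cast
    have hb : (b : R) = -(α * β) := by rw [hp]; ring
    rw [show (α - β) * ((a : R) * (lucasSeq a b (n + 1) : R) + b * (lucasSeq a b n : R)) =
      a * ((α - β) * (lucasSeq a b (n + 1) : R)) + b * ((α - β) * (lucasSeq a b n : R)) by ring,
      h1, h2, ← hs, hb]
    ring

/-- Over an algebraically closed field the characteristic polynomial has two roots. -/
theorem exists_add_eq_mul_eq {K : Type*} [Field K] [IsAlgClosed K] (a b : ℤ) :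
    ∃ α β : K, α + β = a ∧ α * β = -b := by
  obtain ⟨α, hα⟩ := IsAlgClosed.exists_root
    (Polynomial.X ^ 2 - Polynomial.C (a : K) * Polynomial.X - Polynomial.C (b : K)) (by
      have : (Polynomial.X ^ 2 - Polynomial.C (a : K) * Polynomial.X -
        Polynomial.C (b : K)).degree = 2 := by compute_degree!
      rw [this]; decide)
  simp [Polynomial.IsRoot] at hα
  exact ⟨α, a - α, by ring, by linear_combination -hα⟩

theorem IsNondegenerateLucas.lucasSeq_ne_zero (h : IsNondegenerateLucas a b) {n : ℕ}
    (hn : 0 < n) : lucasSeq a b n ≠ 0 := by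
  intro h0
  obtain ⟨α, β, hs, hp⟩ := exists_add_eq_mul_eq (K := ℂ) a b
  have hβ : β ≠ 0 := by
    rintro rfl
    have : (b : ℂ) = 0 := by linear_combination hp
    exact h.right_ne_zero (by exact_mod_cast this)
  have hb := sub_mul_lucasSeq hs hp n
  rw [h0] at hb
  refine h.ratio_not_root_of_unity α β ?_ n hn ?_
  · rw [← hs, show (b : ℂ) = -(α * β) by rw [hp]; ring]
    simp only [Polynomial.C_add, Polynomial.C_neg, Polynomial.C_mul]
    ring
  · rw [div_pow, div_eq_one_iff_eq (pow_ne_zero _ hβ)]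
    have : α ^ n - β ^ n = 0 := by rw [← hb]; simp
    exact sub_eq_zero.mp this

/-- A prime not dividing the discriminant or `b` divides `u (p - 1)` or `u (p + 1)`: Frobenius
either fixes or exchanges the two roots of the characteristic polynomial. -/
theorem prime_dvd_lucasSeq {p : ℕ} (hp : p.Prime) (hb : ¬ (p : ℤ) ∣ b)
    (hD : ¬ (p : ℤ) ∣ a ^ 2 + 4 * b) :
    (p : ℤ) ∣ lucasSeq a b (p - 1) ∨ (p : ℤ) ∣ lucasSeq a b (p + 1) := by
  have := Fact.mk hp
  let K := AlgebraicClosure (ZMod p)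
  have : CharP K p := charP_of_injective_algebraMap (algebraMap (ZMod p) K).injective p
  obtain ⟨α, β, hs, hpr⟩ := exists_add_eq_mul_eq (K := K) a b
  have hz : ∀ t : ℤ, (t : K) = 0 ↔ (p : ℤ) ∣ t := fun t => CharP.intCast_eq_zero_iff K p t
  have hab : α - β ≠ 0 := by
    intro h0
    apply hD
    rw [← hz]
    rw [Int.cast_add, Int.cast_pow, Int.cast_mul, Int.cast_ofNat, ← hs]
    linear_combination (α - β) * h0 + 4 * hpr
  have hb0 : (b : K) ≠ 0 := fun h0 => hb ((hz b).1 h0)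
  have hα : α ≠ 0 := by
    rintro rfl
    apply hb0
    linear_combination hpr
  have hβ : β ≠ 0 := by
    rintro rfl
    apply hb0
    linear_combination hpr
  have key : ∀ n, α ^ n = β ^ n → (p : ℤ) ∣ lucasSeq a b n := by
    intro n hn
    rw [← hz]
    have := sub_mul_lucasSeq hs hpr n
    rw [hn, sub_self] at this
    exact (mul_eq_zero.1 this).resolve_left hab
  have hfrob : ∀ t : ℤ, (t : K) ^ p = t := by
    intro t
    have := congrArg (algebraMap (ZMod p) K) (ZMod.pow_card (t : ZMod p))
    rwa [map_pow, map_intCast] at this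
  have hsum : α ^ p + β ^ p = a := by
    rw [← add_pow_char, hs, hfrob]
  have hmul : α ^ p * β ^ p = -b := by
    rw [← mul_pow, hpr, ← Int.cast_neg, hfrob]
  have hroot : (α ^ p - α) * (α ^ p - β) = 0 := by
    linear_combination (α ^ p) * hsum - hmul - (α ^ p) * hs + hpr
  have hpos := hp.pos
  rcases mul_eq_zero.1 hroot with h1 | h1
  · left
    apply key
    have hα1 : α ^ p = α := sub_eq_zero.1 h1
    have hβ1 : β ^ p = β := by linear_combination hsum - hs - hα1
    have e1 : α ^ (p - 1) = 1 := by
      apply mul_right_cancel₀ hα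
      rw [← pow_succ, Nat.sub_add_cancel hpos, hα1, one_mul]
    have e2 : β ^ (p - 1) = 1 := by
      apply mul_right_cancel₀ hβ
      rw [← pow_succ, Nat.sub_add_cancel hpos, hβ1, one_mul]
    rw [e1, e2]
  · right
    apply key
    have hα1 : α ^ p = β := sub_eq_zero.1 h1
    have hβ1 : β ^ p = α := by linear_combination hsum - hs - hα1
    rw [pow_succ, pow_succ, hα1, hβ1, mul_comm]

/-- Exponential growth of `u`, in the form used for counting prime factors. -/
theorem exists_lucasSeq_natAbs_le (a b : ℤ) :
    ∃ A : ℕ, ∀ n, (lucasSeq a b n).natAbs ≤ (2 ^ A) ^ n := by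
  refine ⟨a.natAbs + b.natAbs, fun n => ?_⟩
  have hC : a.natAbs + b.natAbs ≤ 2 ^ (a.natAbs + b.natAbs) := Nat.lt_two_pow_self.le
  have hC1 : 1 ≤ 2 ^ (a.natAbs + b.natAbs) := Nat.one_le_two_pow
  generalize 2 ^ (a.natAbs + b.natAbs) = C at *
  induction n using Nat.twoStepInduction with
  | zero => simp [lucasSeq]
  | one => simpa [lucasSeq] using hC1
  | more n h1 h2 =>
    calc (lucasSeq a b (n + 2)).natAbs
        ≤ (a * lucasSeq a b (n + 1)).natAbs + (b * lucasSeq a b n).natAbs := by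
          simpa only [lucasSeq] using Int.natAbs_add_le _ _
      _ ≤ a.natAbs * C ^ (n + 1) + b.natAbs * C ^ (n + 1) := by
          rw [Int.natAbs_mul, Int.natAbs_mul]
          gcongr
          exact h1.trans (Nat.pow_le_pow_right hC1 n.le_succ)
      _ = (a.natAbs + b.natAbs) * C ^ (n + 1) := by ring
      _ ≤ C ^ (n + 2) := by
          rw [pow_succ C (n + 1), mul_comm]
          gcongr

end LucasAlgebra

/-! ### Rank of appearance -/

/-- The rank of appearance of `d`: the least index `k > 0` with `d ∣ u k`. It is `0` when `d`
divides no term of positive index. -/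
noncomputable def lucasRank (a b : ℤ) (d : ℕ) : ℕ :=
  sInf {k : ℕ | 0 < k ∧ (d : ℤ) ∣ lucasSeq a b k}

section Rank

variable {a b : ℤ}

theorem lucasRank_spec {d k : ℕ} (hk : 0 < k) (h : (d : ℤ) ∣ lucasSeq a b k) :
    0 < lucasRank a b d ∧ (d : ℤ) ∣ lucasSeq a b (lucasRank a b d) :=
  Nat.sInf_mem (s := {k : ℕ | 0 < k ∧ (d : ℤ) ∣ lucasSeq a b k}) ⟨k, hk, h⟩

theorem dvd_lucasSeq_iff (hab : IsCoprime a b) {d : ℕ} (hd : 0 < lucasRank a b d) {n : ℕ} :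
    (d : ℤ) ∣ lucasSeq a b n ↔ lucasRank a b d ∣ n := by
  have hne : {k : ℕ | 0 < k ∧ (d : ℤ) ∣ lucasSeq a b k}.Nonempty := by
    by_contra h
    rw [Set.not_nonempty_iff_eq_empty] at h
    simp [lucasRank, h] at hd
  have hz : (d : ℤ) ∣ lucasSeq a b (lucasRank a b d) := (Nat.sInf_mem hne).2
  have key := dvd_lucasSeq_mul_add_iff hab hz (n / lucasRank a b d) (n % lucasRank a b d)
  rw [Nat.div_add_mod] at key
  rw [key]
  refine ⟨fun h => ?_, fun h => ?_⟩
  · by_contra hn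
    have hpos : 0 < n % lucasRank a b d := Nat.pos_of_ne_zero fun h0 =>
      hn (Nat.dvd_of_mod_eq_zero h0)
    have := Nat.sInf_le (show n % lucasRank a b d ∈
      {k : ℕ | 0 < k ∧ (d : ℤ) ∣ lucasSeq a b k} from ⟨hpos, h⟩)
    exact absurd (Nat.mod_lt n hd) (not_lt.2 this)
  · rw [Nat.mod_eq_zero_of_dvd h]
    simp [lucasSeq]

theorem lucasRank_pos_of_dvd {d e : ℕ} (he : 0 < lucasRank a b e) (hde : d ∣ e) :
    0 < lucasRank a b d := by
  have hne : {k : ℕ | 0 < k ∧ (e : ℤ) ∣ lucasSeq a b k}.Nonempty := by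
    by_contra h
    rw [Set.not_nonempty_iff_eq_empty] at h
    simp [lucasRank, h] at he
  obtain ⟨k, hk, hek⟩ := hne
  exact (lucasRank_spec hk ((Int.natCast_dvd_natCast.2 hde).trans hek)).1

theorem lucasRank_dvd_of_dvd (hab : IsCoprime a b) {d e : ℕ} (he : 0 < lucasRank a b e)
    (hde : d ∣ e) : lucasRank a b d ∣ lucasRank a b e :=
  (dvd_lucasSeq_iff hab (lucasRank_pos_of_dvd he hde)).1
    ((Int.natCast_dvd_natCast.2 hde).trans ((dvd_lucasSeq_iff hab he).2 dvd_rfl))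

theorem lucasRank_prime_pow_dvd (hab : IsCoprime a b) {p : ℕ} {e : ℕ}
    (hz : 0 < lucasRank a b (p ^ (e + 1))) :
    lucasRank a b (p ^ (e + 1)) ∣ lucasRank a b p * p ^ e := by
  rw [← dvd_lucasSeq_iff hab hz]
  have hzp := lucasRank_pos_of_dvd hz (dvd_pow_self p e.succ_ne_zero)
  clear hz
  induction e with
  | zero => simpa using (dvd_lucasSeq_iff hab hzp).2 dvd_rfl
  | succ e ih =>
    rw [pow_succ p e, ← mul_assoc]
    exact prime_pow_succ_dvd_lucasSeq hab e.succ_pos ih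

/-- Terms of positive index are prime to `b`. -/
theorem not_dvd_of_lucasRank_pos (hab : IsCoprime a b) {p : ℕ} (hp : p.Prime)
    (hz : 0 < lucasRank a b p) : ¬ (p : ℤ) ∣ b := by
  intro h
  have h1 := (dvd_lucasSeq_iff hab hz).2 dvd_rfl
  obtain ⟨k, hk⟩ := Nat.exists_eq_succ_of_ne_zero hz.ne'
  rw [hk] at h1
  have := (lucasSeq_isCoprime_right hab k).isUnit_of_dvd' h1 h
  exact hp.one_lt.ne' (by simpa using Int.isUnit_iff_natAbs_eq.1 this)

theorem lucasRank_prime_dvd (hab : IsCoprime a b) {p : ℕ} (hp : p.Prime)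
    (hz : 0 < lucasRank a b p) (hD : ¬ (p : ℤ) ∣ a ^ 2 + 4 * b) :
    lucasRank a b p ∣ p - 1 ∨ lucasRank a b p ∣ p + 1 := by
  rw [← dvd_lucasSeq_iff hab hz, ← dvd_lucasSeq_iff hab hz]
  exact prime_dvd_lucasSeq hp (not_dvd_of_lucasRank_pos hab hp hz) hD

/-- The discriminant vanishes only when the two roots coincide. -/
theorem IsNondegenerateLucas.discr_ne_zero (h : IsNondegenerateLucas a b) :
    a ^ 2 + 4 * b ≠ 0 := by
  intro h0
  obtain ⟨α, β, hs, hp⟩ := exists_add_eq_mul_eq (K := ℂ) a b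
  have h0' : (a : ℂ) ^ 2 + 4 * b = 0 := by exact_mod_cast congrArg (Int.cast (R := ℂ)) h0
  have hαβ : α = β := by
    have : (α - β) ^ 2 = 0 := by
      rw [← h0', ← hs]
      linear_combination -4 * hp
    exact sub_eq_zero.1 (pow_eq_zero_iff two_ne_zero |>.1 this)
  have hβ : β ≠ 0 := by
    rintro rfl
    have : (b : ℂ) = 0 := by linear_combination hp
    exact h.right_ne_zero (by exact_mod_cast this)
  refine h.ratio_not_root_of_unity α β ?_ 1 one_pos ?_
  · rw [← hs, show (b : ℂ) = -(α * β) by rw [hp]; ring]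
    simp only [Polynomial.C_add, Polynomial.C_neg, Polynomial.C_mul]
    ring
  · rw [hαβ, div_self hβ, one_pow]

/-- A bound for the ranks of the primes dividing the discriminant, which are the primes `p` that may
fail to satisfy `z p ∣ p ± 1`. -/
noncomputable def lucasExceptionalBound (a b : ℤ) : ℕ :=
  3 + ∑ p ∈ (a ^ 2 + 4 * b).natAbs.primeFactors, lucasRank a b p

theorem lucasRank_le_exceptionalBound (h : IsNondegenerateLucas a b) {p : ℕ} (hp : p.Prime)
    (hD : (p : ℤ) ∣ a ^ 2 + 4 * b) : lucasRank a b p ≤ lucasExceptionalBound a b := by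
  have hmem : p ∈ (a ^ 2 + 4 * b).natAbs.primeFactors :=
    Nat.mem_primeFactors.2 ⟨hp, Int.natCast_dvd.1 hD, Int.natAbs_ne_zero.2 h.discr_ne_zero⟩
  exact (Finset.single_le_sum (f := fun p => lucasRank a b p) (fun _ _ => Nat.zero_le _)
    hmem).trans (Nat.le_add_left _ _)

/-- A prime beyond the exceptional bound that divides `z p`, with `p` different from it, is less
than `p`. -/
theorem lt_of_prime_dvd_lucasRank (h : IsNondegenerateLucas a b) {p q : ℕ} (hp : p.Prime)
    (hq : q.Prime) (hpq : p ≠ q) (hz : 0 < lucasRank a b p)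
    (hqE : lucasExceptionalBound a b < q) (hqz : q ∣ lucasRank a b p) : q < p := by
  have h3 : 3 < q := lt_of_le_of_lt (Nat.le_add_right _ _) hqE
  by_cases hD : (p : ℤ) ∣ a ^ 2 + 4 * b
  · have := Nat.le_of_dvd hz hqz
    have := lucasRank_le_exceptionalBound h hp hD
    omega
  · rcases lucasRank_prime_dvd h.coprime hp hz hD with h1 | h1
    · have := Nat.le_of_dvd (Nat.sub_pos_of_lt hp.one_lt) (hqz.trans h1)
      omega
    · have hle := Nat.le_of_dvd p.succ_pos (hqz.trans h1)
      rcases hle.lt_or_eq with hlt | heq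
      · omega
      · exfalso
        -- `p` and `p + 1` cannot both be odd
        have hqo := hq.eq_two_or_odd
        have hpo := hp.eq_two_or_odd
        omega

theorem prime_not_dvd_lucasRank_self (h : IsNondegenerateLucas a b) {q : ℕ} (hq : q.Prime)
    (hz : 0 < lucasRank a b q) (hqE : lucasExceptionalBound a b < q) :
    ¬ q ∣ lucasRank a b q := by
  intro hqz
  by_cases hD : (q : ℤ) ∣ a ^ 2 + 4 * b
  · have := Nat.le_of_dvd hz hqz
    have := lucasRank_le_exceptionalBound h hq hD
    omega
  · rcases lucasRank_prime_dvd h.coprime hq hz hD with h1 | h1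
    · have := Nat.le_of_dvd (Nat.sub_pos_of_lt hq.one_lt) (hqz.trans h1)
      have := hq.pos
      omega
    · have := (Nat.dvd_add_right dvd_rfl).1 (hqz.trans h1)
      exact hq.one_lt.ne' (Nat.dvd_one.1 this)

/-- If `d` and `d'` have the same ratio `w / m` to their ranks, then they have the same prime
factors beyond the exceptional bound. For the largest counterexample `q`, the `q`-adic valuation of
`z d'` exceeds that of `z d`, and only a prime factor `p > q` of `d'` not dividing `d` could
account for it. -/
theorem prime_dvd_of_mul_lucasRank_eq (h : IsNondegenerateLucas a b) {w m d d' : ℕ}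
    (hm : 0 < m) (hd : 0 < d) (hd' : 0 < d')
    (hz : 0 < lucasRank a b d) (hz' : 0 < lucasRank a b d')
    (he : w * lucasRank a b d = m * d) (he' : w * lucasRank a b d' = m * d')
    {q : ℕ} (hq : q.Prime) (hqE : lucasExceptionalBound a b < q) (hqd : q ∣ d') : q ∣ d := by
  by_contra hcon
  have hab := h.coprime
  obtain ⟨q, hqT, hmax⟩ := Finset.exists_max_image
    (d'.primeFactors.filter fun q => lucasExceptionalBound a b < q ∧ ¬ q ∣ d) id
    ⟨q, by simp [hq, hqd, hd'.ne', hqE, hcon]⟩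
  simp only [Finset.mem_filter, Nat.mem_primeFactors, id] at hqT hmax
  clear hq hqE hqd hcon
  obtain ⟨⟨hq, hqd', -⟩, hqE, hqd⟩ := hqT
  have hw : w ≠ 0 := by
    rintro rfl
    have := Nat.mul_pos hm hd
    omega
  have hval : (lucasRank a b d').factorization q =
      (lucasRank a b d).factorization q + d'.factorization q := by
    have e1 := congrArg (fun t => Nat.factorization t q) he
    have e2 := congrArg (fun t => Nat.factorization t q) he'
    simp only [Nat.factorization_mul hw hz.ne', Nat.factorization_mul hw hz'.ne',
      Nat.factorization_mul hm.ne' hd.ne', Nat.factorization_mul hm.ne' hd'.ne',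
      Finsupp.add_apply, Nat.factorization_eq_zero_of_not_dvd hqd] at e1 e2
    omega
  have hd'pos : 0 < d'.factorization q := hq.factorization_pos_of_dvd hd'.ne' hqd'
  set v := (lucasRank a b d').factorization q with hv
  have hqk : q ∣ lucasRank a b d' := by
    refine (hq.dvd_iff_one_le_factorization hz'.ne').2 ?_
    omega
  have hnd : ¬ (d' : ℤ) ∣ lucasSeq a b (lucasRank a b d' / q) := by
    rw [dvd_lucasSeq_iff hab hz']
    intro hdv
    have hlt := Nat.div_lt_self hz' hq.one_lt
    have := Nat.le_of_dvd (Nat.div_pos (Nat.le_of_dvd hz' hqk) hq.pos) hdv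
    omega
  -- some prime power factor of `d'` has rank with the full `q`-adic valuation
  obtain ⟨p, e, hp, hpe, hpn⟩ : ∃ p e : ℕ, p.Prime ∧ p ^ e ∣ d' ∧
      ¬ ((p ^ e : ℕ) : ℤ) ∣ lucasSeq a b (lucasRank a b d' / q) := by
    by_contra! hc
    refine hnd (Int.natCast_dvd.2 ((Nat.dvd_iff_prime_pow_dvd_dvd _ _).2 ?_))
    exact fun p e hp hpe => Int.natCast_dvd.1 (hc p e hp hpe)
  rcases e with _ | e
  · simp at hpn
  have hzpe := lucasRank_pos_of_dvd hz' hpe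
  have hzp := lucasRank_pos_of_dvd hzpe (dvd_pow_self p e.succ_ne_zero)
  have hpd' : p ∣ d' := (dvd_pow_self p e.succ_ne_zero).trans hpe
  rw [dvd_lucasSeq_iff hab hzpe] at hpn
  have hqv : q ^ v ∣ lucasRank a b (p ^ (e + 1)) := by
    obtain ⟨s, hs⟩ := lucasRank_dvd_of_dvd hab hz' hpe
    have hqs : ¬ q ∣ s := by
      rintro ⟨t, rfl⟩
      apply hpn
      rw [hs, show lucasRank a b (p ^ (e + 1)) * (q * t) =
        q * (lucasRank a b (p ^ (e + 1)) * t) by ring, Nat.mul_div_cancel_left _ hq.pos]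
      exact dvd_mul_right _ _
    have := Nat.ordProj_dvd (lucasRank a b d') q
    rw [← hv, hs] at this
    exact (Nat.Coprime.pow_left v ((Nat.Prime.coprime_iff_not_dvd hq).2 hqs)).dvd_of_dvd_mul_right
      this
  have hqv' : q ^ v ∣ lucasRank a b p * p ^ e := hqv.trans (lucasRank_prime_pow_dvd hab hzpe)
  by_cases hpq : p = q
  · subst hpq
    have h1 : p ^ v ∣ p ^ e :=
      (Nat.Coprime.pow_left v ((Nat.Prime.coprime_iff_not_dvd hp).2
        (prime_not_dvd_lucasRank_self h hp hzp hqE))).dvd_of_dvd_mul_left hqv'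
    have h2 := (Nat.pow_dvd_pow_iff_le_right hp.one_lt).1 h1
    have h3 := (hp.pow_dvd_iff_le_factorization hd'.ne').1 hpe
    omega
  · have h1 : q ^ v ∣ lucasRank a b p :=
      (Nat.Coprime.pow v e ((Nat.coprime_primes hq hp).2 (Ne.symm hpq))).dvd_of_dvd_mul_right hqv'
    by_cases hpd : p ∣ d
    · have h2 := (hq.pow_dvd_iff_le_factorization hz.ne').1
        (h1.trans (lucasRank_dvd_of_dvd hab hz hpd))
      omega
    · have h2 : q < p := lt_of_prime_dvd_lucasRank h hp hq hpq hzp hqE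
        ((dvd_pow_self q (by omega)).trans h1)
      have := hmax p ⟨⟨hp, hpd', hd'.ne'⟩, hqE.trans h2, hpd⟩
      omega

end Rank

/-! ### Rankin's method -/

section Rankin

open Finset

/-- Rankin's inequality: integers composed of primes from `P` are bounded by the Euler product
over `P`. -/
theorem sum_rpow_neg_le_prod {c : ℝ} (hc : 0 < c) (s P : Finset ℕ) (hP : ∀ p ∈ P, p.Prime)
    (hs : ∀ n ∈ s, n ≠ 0 ∧ n.primeFactors ⊆ P) :
    ∑ n ∈ s, (n : ℝ) ^ (-c) ≤ ∏ p ∈ P, (1 - (p : ℝ) ^ (-c))⁻¹ := by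
  let f : ℕ →* ℝ :=
    { toFun := fun n => (n : ℝ) ^ (-c)
      map_one' := by simp
      map_mul' := fun m n => by
        push_cast
        exact Real.mul_rpow m.cast_nonneg n.cast_nonneg }
  have hf : ∀ n, f n = (n : ℝ) ^ (-c) := fun _ => rfl
  have hlt : ∀ {p : ℕ}, p.Prime → ‖f p‖ < 1 := by
    intro p hp
    rw [hf, Real.norm_of_nonneg (Real.rpow_nonneg p.cast_nonneg _)]
    exact Real.rpow_lt_one_of_one_lt_of_neg (by exact_mod_cast hp.one_lt) (neg_neg_of_pos hc)
  have h := (EulerProduct.summable_and_hasSum_factoredNumbers_prod_filter_prime_geometric hlt P).2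
  rw [filter_true_of_mem hP] at h
  have h2 := (hasSum_subtype_iff_indicator (f := fun m : ℕ => f m)).1 h
  refine le_trans (le_of_eq ?_) (sum_le_hasSum s (fun i _ => ?_) h2)
  · refine sum_congr rfl fun n hn => ?_
    rw [Set.indicator_of_mem]
    · rfl
    · exact Nat.mem_factoredNumbers_of_primeFactors_subset (hs n hn).1 (hs n hn).2
  · exact Set.indicator_nonneg (fun n _ => Real.rpow_nonneg n.cast_nonneg _) _

theorem card_le_rpow_mul_sum {c X : ℝ} (hc : 0 ≤ c) (s : Finset ℕ)
    (hs : ∀ n ∈ s, 0 < n ∧ (n : ℝ) ≤ X) :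
    (#s : ℝ) ≤ X ^ c * ∑ n ∈ s, (n : ℝ) ^ (-c) := by
  rw [mul_sum, card_eq_sum_ones, Nat.cast_sum]
  refine sum_le_sum fun n hn => ?_
  have hn0 : (0 : ℝ) < n := by exact_mod_cast (hs n hn).1
  rw [Real.rpow_neg hn0.le, ← div_eq_mul_inv, Nat.cast_one, one_le_div (Real.rpow_pos_of_pos hn0 _)]
  exact Real.rpow_le_rpow hn0.le (hs n hn).2 hc

theorem rpow_neg_le_three_quarters {c : ℝ} (hc : 1 / 2 ≤ c) {p : ℕ} (hp : 2 ≤ p) :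
    (p : ℝ) ^ (-c) ≤ 3 / 4 := by
  have hp' : (2 : ℝ) ≤ p := by exact_mod_cast hp
  calc (p : ℝ) ^ (-c) ≤ (p : ℝ) ^ (-(1 / 2) : ℝ) :=
        Real.rpow_le_rpow_of_exponent_le (by linarith) (by linarith)
    _ = (√p)⁻¹ := by rw [Real.rpow_neg (by linarith), Real.sqrt_eq_rpow]
    _ ≤ (4 / 3 : ℝ)⁻¹ := by
        gcongr
        exact Real.le_sqrt_of_sq_le (by linarith)
    _ = 3 / 4 := by norm_num

theorem inv_one_sub_le_exp {t : ℝ} (h0 : 0 ≤ t) (h1 : t ≤ 3 / 4) :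
    (1 - t)⁻¹ ≤ Real.exp (4 * t) := by
  have h2 : (0 : ℝ) < 1 - t := by linarith
  calc (1 - t)⁻¹ ≤ 4 * t + 1 := by
        rw [inv_le_iff_one_le_mul₀ h2]
        nlinarith
    _ ≤ Real.exp (4 * t) := Real.add_one_le_exp _

theorem sum_divisors_rpow_neg_le {c : ℝ} (hc : 1 / 2 ≤ c) (N : ℕ) :
    ∑ n ∈ N.divisors, (n : ℝ) ^ (-c) ≤
      Real.exp (4 * ∑ p ∈ N.primeFactors, (p : ℝ) ^ (-c)) := by
  refine (sum_rpow_neg_le_prod (by linarith) _ N.primeFactors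
    (fun p hp => Nat.prime_of_mem_primeFactors hp) fun n hn => ?_).trans ?_
  · rw [Nat.mem_divisors] at hn
    exact ⟨ne_zero_of_dvd_ne_zero hn.2 hn.1, Nat.primeFactors_mono hn.1 hn.2⟩
  · rw [mul_sum, Real.exp_sum]
    refine prod_le_prod (fun p hp => ?_) fun p hp => ?_
    all_goals
      have h1 := rpow_neg_le_three_quarters hc (Nat.prime_of_mem_primeFactors hp).two_le
    · exact inv_nonneg.2 (by linarith)
    · exact inv_one_sub_le_exp (Real.rpow_nonneg p.cast_nonneg _) h1

/-- Comparison of `∑ j ^ (ρ - 1)` with the corresponding integral. -/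
theorem sum_Icc_rpow_le {ρ : ℝ} (h0 : 0 < ρ) (h1 : ρ ≤ 1) (n : ℕ) :
    ∑ j ∈ Icc 1 n, (j : ℝ) ^ (ρ - 1) ≤ (n : ℝ) ^ ρ / ρ := by
  induction n with
  | zero => simp [Real.zero_rpow h0.ne']
  | succ n ih =>
    rw [sum_Icc_succ_top (by omega)]
    have hn : (0 : ℝ) < n + 1 := by positivity
    have hb := rpow_one_add_le_one_add_mul_self (s := -(1 / ((n : ℝ) + 1)))
      (by rw [neg_le_neg_iff, div_le_one hn]; linarith [(n.cast_nonneg : (0 : ℝ) ≤ n)]) h0.le h1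
    have e1 : 1 + -(1 / ((n : ℝ) + 1)) = n / (n + 1) := by field_simp; ring
    rw [e1, Real.div_rpow n.cast_nonneg hn.le, div_le_iff₀ (Real.rpow_pos_of_pos hn _)] at hb
    have e2 : ((n : ℝ) + 1) ^ (ρ - 1) = (n + 1) ^ ρ / (n + 1) := Real.rpow_sub_one hn.ne' _
    push_cast
    rw [e2]
    have e3 : ((n : ℝ) + 1) ^ ρ / (n + 1) ≤ ((n + 1) ^ ρ - (n : ℝ) ^ ρ) / ρ := by
      rw [le_div_iff₀ h0]
      have : (1 + ρ * -(1 / ((n : ℝ) + 1))) * ((n : ℝ) + 1) ^ ρ =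
        ((n : ℝ) + 1) ^ ρ - ((n : ℝ) + 1) ^ ρ / (n + 1) * ρ := by ring
      linarith
    calc _ ≤ (n : ℝ) ^ ρ / ρ + ((n + 1) ^ ρ - (n : ℝ) ^ ρ) / ρ := add_le_add ih e3
      _ = _ := by ring

/-! ### Chebyshev's bound and reciprocals of primes -/

theorem sum_inv_prime_dyadic_le {i : ℕ} (hi : 0 < i) :
    ∑ p ∈ (Ioc (2 ^ i) (2 ^ (i + 1))).filter Nat.Prime, (1 / p : ℝ) ≤ 4 / i := by
  set S := (Ioc (2 ^ i) (2 ^ (i + 1))).filter Nat.Prime with hS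
  have h1 : (2 ^ i) ^ #S ≤ 2 ^ (2 ^ (i + 2)) := by
    calc (2 ^ i) ^ #S = ∏ p ∈ S, 2 ^ i := by rw [prod_const]
      _ ≤ ∏ p ∈ S, p := by
          refine prod_le_prod' fun p hp => ?_
          simp only [hS, mem_filter, mem_Ioc] at hp
          exact hp.1.1.le
      _ ≤ primorial (2 ^ (i + 1)) := by
          unfold primorial
          refine prod_le_prod_of_subset_of_one_le' (fun p hp => ?_) fun p hp _ => ?_
          · simp only [hS, mem_filter, mem_Ioc] at hp
            simp only [mem_filter, mem_range]
            exact ⟨by omega, hp.2⟩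
          · exact (mem_filter.1 hp).2.one_lt.le
      _ ≤ 4 ^ (2 ^ (i + 1)) := primorial_le_four_pow _
      _ = 2 ^ (2 ^ (i + 2)) := by
          rw [show (4 : ℕ) = 2 ^ 2 by norm_num, ← pow_mul]
          congr 1
          ring
  rw [← pow_mul] at h1
  have h2 : i * #S ≤ 2 ^ (i + 2) := (Nat.pow_le_pow_iff_right one_lt_two).1 h1
  have h2' : (i : ℝ) * #S ≤ 4 * 2 ^ i := by
    have : ((i * #S : ℕ) : ℝ) ≤ ((2 ^ (i + 2) : ℕ) : ℝ) := by exact_mod_cast h2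
    push_cast at this
    rw [pow_add] at this
    linarith
  have hi' : (0 : ℝ) < i := by exact_mod_cast hi
  calc ∑ p ∈ S, (1 / p : ℝ) ≤ ∑ p ∈ S, 1 / (2 : ℝ) ^ i := by
        refine sum_le_sum fun p hp => ?_
        simp only [hS, mem_filter, mem_Ioc] at hp
        have : ((2 : ℝ) ^ i) ≤ p := by exact_mod_cast hp.1.1.le
        gcongr
    _ = #S / (2 : ℝ) ^ i := by rw [sum_const, nsmul_eq_mul, mul_one_div]
    _ ≤ 4 / i := by
        rw [div_le_div_iff₀ (by positivity) hi']
        linarith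

theorem sum_inv_prime_le_harmonic (n : ℕ) :
    ∑ p ∈ (Ioc 0 (2 ^ (n + 1))).filter Nat.Prime, (1 / p : ℝ) ≤
      1 + 4 * ((harmonic n : ℚ) : ℝ) := by
  induction n with
  | zero =>
    have : (Ioc 0 (2 ^ (0 + 1))).filter Nat.Prime = {2} := by decide
    rw [this]
    norm_num
  | succ n ih =>
    have hsplit : (Ioc 0 (2 ^ (n + 1 + 1))).filter Nat.Prime =
        (Ioc 0 (2 ^ (n + 1))).filter Nat.Prime ∪
          (Ioc (2 ^ (n + 1)) (2 ^ (n + 1 + 1))).filter Nat.Prime := by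
      rw [← filter_union, Ioc_union_Ioc_eq_Ioc (Nat.zero_le _)
        (Nat.pow_le_pow_right two_pos (Nat.le_succ _))]
    have hdisj : Disjoint ((Ioc 0 (2 ^ (n + 1))).filter Nat.Prime)
        ((Ioc (2 ^ (n + 1)) (2 ^ (n + 1 + 1))).filter Nat.Prime) :=
      disjoint_filter_filter (Ioc_disjoint_Ioc_of_le le_rfl)
    rw [hsplit, sum_union hdisj, harmonic_succ]
    have := sum_inv_prime_dyadic_le n.succ_pos
    push_cast at this ⊢
    rw [div_eq_mul_inv (4 : ℝ)] at this
    linarith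

/-- A weak form of Mertens' theorem. -/
theorem sum_inv_prime_le {y : ℝ} (hy : 2 ≤ y) :
    ∑ p ∈ (Ioc 0 ⌊y⌋₊).filter Nat.Prime, (1 / p : ℝ) ≤ 5 + 4 * Real.log (2 * Real.log y) := by
  have hy0 : (0 : ℝ) < y := by linarith
  set n := Nat.log 2 ⌊y⌋₊ with hn
  have hfl : ⌊y⌋₊ ≠ 0 := by
    have := Nat.le_floor (show ((1 : ℕ) : ℝ) ≤ y by norm_num; linarith)
    omega
  have hlt : ⌊y⌋₊ < 2 ^ (n + 1) := Nat.lt_pow_succ_log_self one_lt_two _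
  have hle : 2 ^ n ≤ ⌊y⌋₊ := Nat.pow_log_le_self 2 hfl
  have hn1 : 1 ≤ n := by
    have : 2 ≤ ⌊y⌋₊ := Nat.le_floor (by exact_mod_cast hy)
    exact Nat.log_pos one_lt_two this
  have hnlog : (n : ℝ) ≤ 2 * Real.log y := by
    have h1 : (2 : ℝ) ^ n ≤ y := by
      calc (2 : ℝ) ^ n = ((2 ^ n : ℕ) : ℝ) := by push_cast; rfl
        _ ≤ (⌊y⌋₊ : ℝ) := by exact_mod_cast hle
        _ ≤ y := Nat.floor_le hy0.le
    have h2 := Real.log_le_log (by positivity) h1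
    rw [Real.log_pow] at h2
    have := Real.log_two_gt_d9
    have hn0 : (0 : ℝ) ≤ n := n.cast_nonneg
    nlinarith
  calc _ ≤ ∑ p ∈ (Ioc 0 (2 ^ (n + 1))).filter Nat.Prime, (1 / p : ℝ) := by
        refine sum_le_sum_of_subset_of_nonneg (filter_subset_filter _ ?_) fun p _ _ => by positivity
        exact Ioc_subset_Ioc_right hlt.le
    _ ≤ 1 + 4 * ((harmonic n : ℚ) : ℝ) := sum_inv_prime_le_harmonic n
    _ ≤ 1 + 4 * (1 + Real.log n) := by gcongr; exact harmonic_le_one_add_log n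
    _ ≤ 1 + 4 * (1 + Real.log (2 * Real.log y)) := by gcongr
    _ = _ := by ring

/-! ### Sums over divisors -/

theorem card_primeFactors_le {k : ℕ} (hk : k ≠ 0) :
    (#k.primeFactors : ℝ) ≤ 2 * Real.log k := by
  have h1 : 2 ^ #k.primeFactors ≤ k := by
    calc 2 ^ #k.primeFactors = ∏ p ∈ k.primeFactors, 2 := by rw [prod_const]
      _ ≤ ∏ p ∈ k.primeFactors, p :=
          prod_le_prod' fun p hp => (Nat.prime_of_mem_primeFactors hp).two_le
      _ ≤ k := Nat.le_of_dvd (Nat.pos_of_ne_zero hk) (Nat.prod_primeFactors_dvd k)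
  have h2 : Real.log ((2 : ℝ) ^ #k.primeFactors) ≤ Real.log k :=
    Real.log_le_log (by positivity) (by exact_mod_cast h1)
  rw [Real.log_pow] at h2
  have := Real.log_two_gt_d9
  have hn0 : (0 : ℝ) ≤ #k.primeFactors := Nat.cast_nonneg _
  nlinarith

/-- The primes up to `y` and those beyond `y` are estimated separately, `log k ≤ y`. -/
theorem sum_primeFactors_rpow_le {k : ℕ} (hk : k ≠ 0) {y η : ℝ} (hy : 2 ≤ y)
    (hky : Real.log k ≤ y) (h0 : 0 ≤ η) (h1 : η ≤ 1) :
    ∑ p ∈ k.primeFactors, (p : ℝ) ^ (-(1 - η)) ≤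
      y ^ η * (7 + 4 * Real.log (2 * Real.log y)) := by
  have hy0 : (0 : ℝ) < y := by linarith
  rw [← sum_filter_add_sum_filter_not k.primeFactors (fun p => p ≤ ⌊y⌋₊)]
  have hyη : 0 ≤ y ^ η := Real.rpow_nonneg hy0.le _
  have hA : ∑ p ∈ k.primeFactors with p ≤ ⌊y⌋₊, (p : ℝ) ^ (-(1 - η)) ≤
      y ^ η * (5 + 4 * Real.log (2 * Real.log y)) := by
    calc _ ≤ ∑ p ∈ k.primeFactors with p ≤ ⌊y⌋₊, y ^ η * (1 / p : ℝ) := by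
          refine sum_le_sum fun p hp => ?_
          simp only [mem_filter, Nat.mem_primeFactors] at hp
          have hp0 : (0 : ℝ) < p := by exact_mod_cast hp.1.1.pos
          have hpy : (p : ℝ) ≤ y := (Nat.le_floor_iff hy0.le).1 hp.2
          rw [show -(1 - η) = η - 1 by ring, Real.rpow_sub_one hp0.ne', mul_one_div]
          gcongr
      _ ≤ ∑ p ∈ (Ioc 0 ⌊y⌋₊).filter Nat.Prime, y ^ η * (1 / p : ℝ) := by
          refine sum_le_sum_of_subset_of_nonneg (fun p hp => ?_) fun p _ _ => by positivity
          simp only [mem_filter, Nat.mem_primeFactors] at hp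
          simp only [mem_filter, mem_Ioc]
          exact ⟨⟨hp.1.1.pos, hp.2⟩, hp.1.1⟩
      _ ≤ _ := by
          rw [← mul_sum]
          exact mul_le_mul_of_nonneg_left (sum_inv_prime_le hy) hyη
  have hB : ∑ p ∈ k.primeFactors with ¬ p ≤ ⌊y⌋₊, (p : ℝ) ^ (-(1 - η)) ≤ y ^ η * 2 := by
    calc _ ≤ ∑ p ∈ k.primeFactors with ¬ p ≤ ⌊y⌋₊, y ^ (-(1 - η)) := by
          refine sum_le_sum fun p hp => ?_
          simp only [mem_filter] at hp
          have hpy : y ≤ p := ((Nat.floor_lt hy0.le).1 (not_le.1 hp.2)).le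
          exact Real.rpow_le_rpow_of_nonpos hy0 hpy (by linarith)
      _ = #(k.primeFactors.filter fun p => ¬ p ≤ ⌊y⌋₊) * y ^ (-(1 - η)) := by
          rw [sum_const, nsmul_eq_mul]
      _ ≤ (2 * y) * y ^ (-(1 - η)) := by
          gcongr
          refine le_trans ?_ ((card_primeFactors_le hk).trans (by linarith))
          exact_mod_cast card_filter_le _ _
      _ = y ^ η * 2 := by
          rw [show -(1 - η) = η - 1 by ring, Real.rpow_sub_one hy0.ne']
          field_simp
  linarith

theorem sum_divisors_rpow_le {k : ℕ} (hk : k ≠ 0) {y η : ℝ} (hy : 2 ≤ y)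
    (hky : Real.log k ≤ y) (h0 : 0 ≤ η) (h1 : η ≤ 1 / 2) :
    ∑ d ∈ k.divisors, (d : ℝ) ^ (-(1 - η)) ≤
      Real.exp (4 * (y ^ η * (7 + 4 * Real.log (2 * Real.log y)))) := by
  refine (sum_divisors_rpow_neg_le (by linarith) k).trans (Real.exp_le_exp.2 ?_)
  exact mul_le_mul_of_nonneg_left
    (sum_primeFactors_rpow_le hk hy hky h0 (by linarith)) (by norm_num)

end Rankin

/-! ### Prime factors of the terms -/

section PrimeFactors

open Finset

variable {a b : ℤ}

theorem exists_card_primeFactors_lucasSeq_le (h : IsNondegenerateLucas a b) :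
    ∃ A : ℕ, ∀ n, 0 < n → #(lucasSeq a b n).natAbs.primeFactors ≤ A * n := by
  obtain ⟨A, hA⟩ := exists_lucasSeq_natAbs_le a b
  refine ⟨A, fun n hn => ?_⟩
  have hne : (lucasSeq a b n).natAbs ≠ 0 := Int.natAbs_ne_zero.2 (h.lucasSeq_ne_zero hn)
  refine (Nat.pow_le_pow_iff_right one_lt_two).1 ?_
  calc 2 ^ #(lucasSeq a b n).natAbs.primeFactors
      = ∏ p ∈ (lucasSeq a b n).natAbs.primeFactors, 2 := by rw [prod_const]
    _ ≤ ∏ p ∈ (lucasSeq a b n).natAbs.primeFactors, p :=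
        prod_le_prod' fun p hp => (Nat.prime_of_mem_primeFactors hp).two_le
    _ ≤ (lucasSeq a b n).natAbs :=
        Nat.le_of_dvd (Nat.pos_of_ne_zero hne) (Nat.prod_primeFactors_dvd _)
    _ ≤ (2 ^ A) ^ n := hA n
    _ = 2 ^ (A * n) := by rw [pow_mul]

/-- The primes of rank `d` that do not divide the discriminant. -/
noncomputable def primesOfRank (a b : ℤ) (d : ℕ) : Finset ℕ :=
  (lucasSeq a b d).natAbs.primeFactors.filter fun p =>
    lucasRank a b p = d ∧ ¬ (p : ℤ) ∣ a ^ 2 + 4 * b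

theorem sum_le_sum_of_injOn_of_le {s t : Finset ℕ} {f g : ℕ → ℝ} (φ : ℕ → ℕ)
    (hφ : ∀ i ∈ s, φ i ∈ t) (hinj : Set.InjOn φ s) (hfg : ∀ i ∈ s, f i ≤ g (φ i))
    (hg : ∀ j ∈ t, 0 ≤ g j) : ∑ i ∈ s, f i ≤ ∑ j ∈ t, g j := by
  calc ∑ i ∈ s, f i ≤ ∑ i ∈ s, g (φ i) := sum_le_sum hfg
    _ = ∑ j ∈ s.image φ, g j := (sum_image hinj).symm
    _ ≤ ∑ j ∈ t, g j := sum_le_sum_of_subset_of_nonneg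
        (fun j hj => by
          obtain ⟨i, hi, rfl⟩ := mem_image.1 hj
          exact hφ i hi) fun j hj _ => hg j hj

theorem sum_union_le_add {f : ℕ → ℝ} (hf : ∀ i, 0 ≤ f i) (s t : Finset ℕ) :
    ∑ i ∈ s ∪ t, f i ≤ ∑ i ∈ s, f i + ∑ i ∈ t, f i := by
  rw [← sum_union_inter]
  exact le_add_of_nonneg_right (sum_nonneg fun i _ => hf i)

theorem sum_Icc_progression_le {ρ : ℝ} (h0 : 0 < ρ) (h1 : ρ ≤ 1) {d : ℕ} (hd : 0 < d) :
    ∑ j ∈ Icc 1 d, 2 * ((j : ℝ) * d) ^ (ρ - 1) ≤ 2 / ρ * (d : ℝ) ^ (2 * ρ - 1) := by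
  have hd' : (0 : ℝ) < d := by exact_mod_cast hd
  calc ∑ j ∈ Icc 1 d, 2 * ((j : ℝ) * d) ^ (ρ - 1)
      = 2 * (d : ℝ) ^ (ρ - 1) * ∑ j ∈ Icc 1 d, (j : ℝ) ^ (ρ - 1) := by
        rw [mul_sum]
        refine sum_congr rfl fun j _ => ?_
        rw [Real.mul_rpow j.cast_nonneg hd'.le]
        ring
    _ ≤ 2 * (d : ℝ) ^ (ρ - 1) * ((d : ℝ) ^ ρ / ρ) := by
        gcongr
        exact sum_Icc_rpow_le h0 h1 d
    _ = 2 / ρ * (d : ℝ) ^ (2 * ρ - 1) := by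
        rw [show 2 * ρ - 1 = (ρ - 1) + ρ by ring, Real.rpow_add hd']
        ring

/-- The primes of rank `d` lie in the progressions `± 1` modulo `d`, which controls those up to
`d ^ 2`; the larger ones are few because they all divide `u d`. -/
theorem sum_primesOfRank_rpow_le (h : IsNondegenerateLucas a b) {A : ℕ}
    (hA : ∀ n, 0 < n → #(lucasSeq a b n).natAbs.primeFactors ≤ A * n) {ρ : ℝ} (h0 : 0 < ρ)
    (h1 : ρ ≤ 1 / 2) {d : ℕ} (hd : 0 < d) :
    ∑ p ∈ primesOfRank a b d, (p : ℝ) ^ (-(1 - ρ)) ≤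
      (A + 4) / ρ * (d : ℝ) ^ (-(1 - 2 * ρ)) := by
  rcases Nat.lt_or_ge d 2 with hd1 | hd2
  · have : d = 1 := by omega
    subst this
    have he : primesOfRank a b 1 = ∅ := by simp [primesOfRank, lucasSeq]
    rw [he, sum_empty]
    positivity
  have hd' : (0 : ℝ) < d := by exact_mod_cast hd
  rw [show -(1 - ρ) = ρ - 1 by ring, show -(1 - 2 * ρ) = 2 * ρ - 1 by ring]
  set Q := primesOfRank a b d with hQ
  have hprime : ∀ p ∈ Q, p.Prime := fun p hp =>
    Nat.prime_of_mem_primeFactors (mem_filter.1 hp).1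
  have hmod : ∀ p ∈ Q, d ∣ p - 1 ∨ d ∣ p + 1 := by
    intro p hp
    simp only [hQ, primesOfRank, mem_filter] at hp
    have hz : 0 < lucasRank a b p := by omega
    have := lucasRank_prime_dvd h.coprime (Nat.prime_of_mem_primeFactors hp.1) hz hp.2.2
    rwa [hp.2.1] at this
  have hnn : ∀ p : ℕ, 0 ≤ (p : ℝ) ^ (ρ - 1) := fun p => Real.rpow_nonneg p.cast_nonneg _
  have hG : ∀ j ∈ Icc 1 d, 0 ≤ 2 * ((j : ℝ) * d) ^ (ρ - 1) := fun j _ => by positivity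
  have hsplit : Q ⊆ (Q.filter fun p => p ≤ d ^ 2 ∧ d ∣ p - 1) ∪
      (Q.filter fun p => p ≤ d ^ 2 ∧ d ∣ p + 1) ∪ (Q.filter fun p => d ^ 2 < p) := by
    intro p hp
    simp only [mem_union, mem_filter]
    rcases le_or_gt p (d ^ 2) with h2 | h2
    · rcases hmod p hp with h3 | h3
      · exact Or.inl (Or.inl ⟨hp, h2, h3⟩)
      · exact Or.inl (Or.inr ⟨hp, h2, h3⟩)
    · exact Or.inr ⟨hp, h2⟩
  have hminus : ∑ p ∈ Q.filter (fun p => p ≤ d ^ 2 ∧ d ∣ p - 1), (p : ℝ) ^ (ρ - 1) ≤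
      2 / ρ * (d : ℝ) ^ (2 * ρ - 1) := by
    refine le_trans (sum_le_sum_of_injOn_of_le (fun p => (p - 1) / d) (t := Icc 1 d)
      (fun p hp => ?_) (fun p hp q hq hpq => ?_) (fun p hp => ?_) hG)
      (sum_Icc_progression_le h0 (by linarith) hd)
    · obtain ⟨hp, h2, j, hj⟩ := mem_filter.1 hp
      have := (hprime p hp).two_le
      simp only [hj, Nat.mul_div_cancel_left _ hd, mem_Icc]
      refine ⟨Nat.pos_of_ne_zero ?_, ?_⟩
      · rintro rfl
        omega
      · by_contra hcon
        have : d * (d + 1) ≤ d * j := Nat.mul_le_mul_left d (by omega)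
        have : p - 1 < d ^ 2 := by omega
        nlinarith
    · obtain ⟨hp, -, i, hi⟩ := mem_filter.1 hp
      obtain ⟨hq, -, j, hj⟩ := mem_filter.1 hq
      simp only [hi, hj, Nat.mul_div_cancel_left _ hd] at hpq
      subst hpq
      have := (hprime p hp).two_le
      have := (hprime q hq).two_le
      omega
    · obtain ⟨hp, -, j, hj⟩ := mem_filter.1 hp
      have h2 := (hprime p hp).two_le
      simp only [hj, Nat.mul_div_cancel_left _ hd]
      have hjd : 0 < j * d := by rw [mul_comm]; omega
      have hle : ((j : ℝ) * d) ≤ p := by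
        have : j * d ≤ p := by rw [mul_comm]; omega
        exact_mod_cast this
      have hpos : 0 < (j : ℝ) * d := by exact_mod_cast hjd
      have := Real.rpow_le_rpow_of_nonpos hpos hle (show ρ - 1 ≤ 0 by linarith)
      have := Real.rpow_nonneg hpos.le (ρ - 1)
      linarith
  have hplus : ∑ p ∈ Q.filter (fun p => p ≤ d ^ 2 ∧ d ∣ p + 1), (p : ℝ) ^ (ρ - 1) ≤
      2 / ρ * (d : ℝ) ^ (2 * ρ - 1) := by
    refine le_trans (sum_le_sum_of_injOn_of_le (fun p => (p + 1) / d) (t := Icc 1 d)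
      (fun p hp => ?_) (fun p hp q hq hpq => ?_) (fun p hp => ?_) hG)
      (sum_Icc_progression_le h0 (by linarith) hd)
    · obtain ⟨hp, h2, j, hj⟩ := mem_filter.1 hp
      simp only [hj, Nat.mul_div_cancel_left _ hd, mem_Icc]
      refine ⟨Nat.pos_of_ne_zero ?_, ?_⟩
      · rintro rfl
        omega
      · by_contra hcon
        have : d * (d + 1) ≤ d * j := Nat.mul_le_mul_left d (by omega)
        nlinarith
    · obtain ⟨hp, -, i, hi⟩ := mem_filter.1 hp
      obtain ⟨hq, -, j, hj⟩ := mem_filter.1 hq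
      simp only [hi, hj, Nat.mul_div_cancel_left _ hd] at hpq
      subst hpq
      omega
    · obtain ⟨hp, -, j, hj⟩ := mem_filter.1 hp
      have h2 := (hprime p hp).two_le
      simp only [hj, Nat.mul_div_cancel_left _ hd]
      have hjd : ((j : ℝ) * d) = p + 1 := by
        have : j * d = p + 1 := by rw [mul_comm]; omega
        exact_mod_cast this
      have hp2 : (2 : ℝ) ≤ p := by exact_mod_cast h2
      have hpos : 0 < (j : ℝ) * d := by rw [hjd]; linarith
      calc (p : ℝ) ^ (ρ - 1) ≤ ((j : ℝ) * d / 2) ^ (ρ - 1) :=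
            Real.rpow_le_rpow_of_nonpos (by linarith) (by rw [hjd]; linarith) (by linarith)
        _ = ((j : ℝ) * d) ^ (ρ - 1) * (2 : ℝ) ^ (1 - ρ) := by
            rw [Real.div_rpow hpos.le zero_le_two, show 1 - ρ = -(ρ - 1) by ring,
              Real.rpow_neg zero_le_two, div_eq_mul_inv]
        _ ≤ ((j : ℝ) * d) ^ (ρ - 1) * (2 : ℝ) ^ (1 : ℝ) := by
            gcongr
            · norm_num
            · linarith
        _ = 2 * ((j : ℝ) * d) ^ (ρ - 1) := by rw [Real.rpow_one, mul_comm]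
  have hlarge : ∑ p ∈ Q.filter (fun p => d ^ 2 < p), (p : ℝ) ^ (ρ - 1) ≤
      A / ρ * (d : ℝ) ^ (2 * ρ - 1) := by
    calc _ ≤ ∑ p ∈ Q.filter (fun p => d ^ 2 < p), ((d : ℝ) ^ (2 : ℝ)) ^ (ρ - 1) := by
          refine sum_le_sum fun p hp => ?_
          have : d ^ 2 < p := (mem_filter.1 hp).2
          refine Real.rpow_le_rpow_of_nonpos (by positivity) ?_ (by linarith)
          rw [Real.rpow_two]
          exact_mod_cast this.le
      _ = #(Q.filter fun p => d ^ 2 < p) * ((d : ℝ) ^ (2 : ℝ)) ^ (ρ - 1) := by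
          rw [sum_const, nsmul_eq_mul]
      _ ≤ (A * d) * ((d : ℝ) ^ (2 : ℝ)) ^ (ρ - 1) := by
          gcongr
          have : #(Q.filter fun p => d ^ 2 < p) ≤ A * d :=
            (card_filter_le _ _).trans ((card_filter_le _ _).trans (hA d hd))
          exact_mod_cast this
      _ = A * (d : ℝ) ^ (2 * ρ - 1) := by
          rw [← Real.rpow_mul hd'.le, mul_assoc]
          congr 1
          nth_rewrite 1 [← Real.rpow_one (d : ℝ)]
          rw [← Real.rpow_add hd']
          congr 1
          ring
      _ ≤ A / ρ * (d : ℝ) ^ (2 * ρ - 1) := by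
          gcongr
          exact le_div_self A.cast_nonneg h0 (by linarith)
  calc ∑ p ∈ Q, (p : ℝ) ^ (ρ - 1)
      ≤ ∑ p ∈ (Q.filter fun p => p ≤ d ^ 2 ∧ d ∣ p - 1) ∪
          (Q.filter fun p => p ≤ d ^ 2 ∧ d ∣ p + 1) ∪ (Q.filter fun p => d ^ 2 < p),
          (p : ℝ) ^ (ρ - 1) := sum_le_sum_of_subset_of_nonneg hsplit fun p _ _ => hnn p
    _ ≤ _ := sum_union_le_add hnn _ _
    _ ≤ _ := add_le_add_left (sum_union_le_add hnn _ _) _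
    _ ≤ _ := add_le_add (add_le_add hminus hplus) hlarge
    _ = _ := by ring

theorem sum_primeFactors_lucasSeq_rpow_le (h : IsNondegenerateLucas a b) {A : ℕ}
    (hA : ∀ n, 0 < n → #(lucasSeq a b n).natAbs.primeFactors ≤ A * n) {ρ : ℝ} (h0 : 0 < ρ)
    (h1 : ρ ≤ 1 / 2) {k : ℕ} (hk : 0 < k) :
    ∑ p ∈ (lucasSeq a b k).natAbs.primeFactors, (p : ℝ) ^ (-(1 - ρ)) ≤
      #(a ^ 2 + 4 * b).natAbs.primeFactors +
        (A + 4) / ρ * ∑ d ∈ k.divisors, (d : ℝ) ^ (-(1 - 2 * ρ)) := by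
  have hnn : ∀ p : ℕ, 0 ≤ (p : ℝ) ^ (-(1 - ρ)) := fun p => Real.rpow_nonneg p.cast_nonneg _
  rw [← sum_filter_add_sum_filter_not _ (fun p : ℕ => (p : ℤ) ∣ a ^ 2 + 4 * b)]
  refine add_le_add ?_ ?_
  · calc _ ≤ ∑ p ∈ (a ^ 2 + 4 * b).natAbs.primeFactors, ((p : ℕ) : ℝ) ^ (-(1 - ρ)) := by
          refine sum_le_sum_of_subset_of_nonneg (fun p hp => ?_) fun p _ _ => hnn p
          obtain ⟨hp, hD⟩ := mem_filter.1 hp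
          exact Nat.mem_primeFactors.2 ⟨Nat.prime_of_mem_primeFactors hp, Int.natCast_dvd.1 hD,
            Int.natAbs_ne_zero.2 h.discr_ne_zero⟩
      _ ≤ ∑ p ∈ (a ^ 2 + 4 * b).natAbs.primeFactors, (1 : ℝ) := by
          refine sum_le_sum fun p hp => ?_
          exact Real.rpow_le_one_of_one_le_of_nonpos
            (by exact_mod_cast (Nat.prime_of_mem_primeFactors hp).one_lt.le) (by linarith)
      _ = _ := by simp
  · have hmaps : ∀ p ∈ (lucasSeq a b k).natAbs.primeFactors.filter
        (fun p : ℕ => ¬ (p : ℤ) ∣ a ^ 2 + 4 * b), lucasRank a b p ∈ k.divisors := by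
      intro p hp
      have hdvd : (p : ℤ) ∣ lucasSeq a b k :=
        Int.natCast_dvd.2 (Nat.dvd_of_mem_primeFactors (mem_filter.1 hp).1)
      exact Nat.mem_divisors.2
        ⟨(dvd_lucasSeq_iff h.coprime (lucasRank_spec hk hdvd).1).1 hdvd, hk.ne'⟩
    rw [← sum_fiberwise_of_maps_to hmaps, mul_sum]
    refine sum_le_sum fun d hd => ?_
    have hd0 : 0 < d := Nat.pos_of_mem_divisors hd
    refine le_trans (sum_le_sum_of_subset_of_nonneg (fun p hp => ?_) fun p _ _ => hnn p)
      (sum_primesOfRank_rpow_le h hA h0 h1 hd0)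
    simp only [mem_filter] at hp
    obtain ⟨⟨hp, hD⟩, rfl⟩ := hp
    have hdvd : (p : ℤ) ∣ lucasSeq a b k := Int.natCast_dvd.2 (Nat.dvd_of_mem_primeFactors hp)
    exact mem_filter.2 ⟨Nat.mem_primeFactors.2 ⟨Nat.prime_of_mem_primeFactors hp,
      Int.natCast_dvd.1 (lucasRank_spec hk hdvd).2,
      Int.natAbs_ne_zero.2 (h.lucasSeq_ne_zero hd0)⟩, rfl, hD⟩

end PrimeFactors

/-! ### Uniform estimate for sums over divisors of a term -/

section Uniform

open Finset Filter Topology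

/-- The iterated logarithms in the exponent, `log log log x / log log x`. -/
noncomputable def logRatio (x : ℝ) : ℝ :=
  Real.log (Real.log (Real.log x)) / Real.log (Real.log x)

theorem tendsto_log_log : Tendsto (fun x : ℝ => Real.log (Real.log x)) atTop atTop :=
  Real.tendsto_log_atTop.comp Real.tendsto_log_atTop

theorem eventually_rpow_mul_log_le {δ : ℝ} (hδ : 0 < δ) :
    ∀ᶠ t : ℝ in atTop, 4 * (t ^ (1 - 2 * δ) * (7 + 4 * Real.log (2 * t))) ≤ t / 2 := by
  have h1 := (isLittleO_log_rpow_atTop (show 0 < 2 * δ by linarith)).bound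
    (show (0 : ℝ) < 1 / 120 by norm_num)
  filter_upwards [h1, eventually_ge_atTop (Real.exp 1)] with t ht hte
  have ht1 : 1 ≤ Real.log t := by
    rw [← Real.log_exp 1]
    exact Real.log_le_log (Real.exp_pos 1) hte
  have ht0 : 0 < t := (Real.exp_pos 1).trans_le hte
  have hpow : 0 < t ^ (2 * δ) := Real.rpow_pos_of_pos ht0 _
  rw [Real.norm_of_nonneg (by linarith), Real.norm_of_nonneg hpow.le] at ht
  rw [Real.log_mul two_ne_zero ht0.ne', Real.rpow_sub ht0, Real.rpow_one]
  have hl2 := Real.log_two_lt_d9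
  have : 7 + 4 * (Real.log 2 + Real.log t) ≤ t ^ (2 * δ) / 8 := by linarith
  calc 4 * (t / t ^ (2 * δ) * (7 + 4 * (Real.log 2 + Real.log t)))
      ≤ 4 * (t / t ^ (2 * δ) * (t ^ (2 * δ) / 8)) := by gcongr
    _ = t / 2 := by field_simp; norm_num

theorem eventually_mul_exp_half_le (C D : ℝ) {δ : ℝ} (hC : 0 ≤ C) (hD : 0 ≤ D) (hδ : 0 < δ) :
    ∀ᶠ t : ℝ in atTop, D + C * t * Real.exp (t / 2) ≤ δ * (Real.exp t / t) := by
  have h1 := (isLittleO_pow_exp_pos_mul_atTop (b := 1 / 2) 2 (by norm_num)).bound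
    (show 0 < δ / (C + D + 1) by positivity)
  filter_upwards [h1, eventually_ge_atTop 1] with t ht ht1
  have ht0 : 0 < t := by linarith
  rw [Real.norm_of_nonneg (by positivity), Real.norm_of_nonneg (Real.exp_pos _).le,
    show 1 / 2 * t = t / 2 by ring, div_mul_eq_mul_div, le_div_iff₀ (by positivity)] at ht
  have he : Real.exp t = Real.exp (t / 2) * Real.exp (t / 2) := by
    rw [← Real.exp_add]; congr 1; ring
  have he1 : 1 ≤ Real.exp (t / 2) := Real.one_le_exp (by linarith)
  rw [← mul_div_assoc, le_div_iff₀ ht0, he]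
  have hDt : D * t ≤ D * t ^ 2 * Real.exp (t / 2) := by
    have : D * t * 1 ≤ (D * t) * (t * Real.exp (t / 2)) := by
      gcongr
      nlinarith
    linarith
  have hm := mul_le_mul_of_nonneg_right ht (Real.exp_pos (t / 2)).le
  nlinarith [mul_pos (pow_pos ht0 2) (Real.exp_pos (t / 2))]

variable {a b : ℤ}

/-- The Rankin sum over divisors of `u k` with exponent `1 - ρ`, `ρ` slightly less than half of
`logRatio x`, is negligible uniformly in `k ≤ x`. -/
theorem eventually_sum_divisors_lucasSeq_le (h : IsNondegenerateLucas a b) {δ : ℝ} (hδ : 0 < δ)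
    (hδ' : δ < 1 / 2) :
    ∀ᶠ x : ℝ in atTop, ∀ k : ℕ, 0 < k → (k : ℝ) ≤ x →
      ∑ f ∈ (lucasSeq a b k).natAbs.divisors,
        (f : ℝ) ^ (-(1 - (1 / 2 - δ) * logRatio x)) ≤ x ^ (δ * logRatio x) := by
  obtain ⟨A, hA⟩ := exists_card_primeFactors_lucasSeq_le h
  set N : ℝ := ((#(a ^ 2 + 4 * b).natAbs.primeFactors : ℕ) : ℝ) with hN
  have hhalf : 0 < 1 / 2 - δ := by linarith
  filter_upwards [tendsto_log_log.eventually (eventually_rpow_mul_log_le hδ),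
    tendsto_log_log.eventually (eventually_mul_exp_half_le (4 * ((A + 4) / (1 / 2 - δ))) (4 * N)
      (by positivity) (by positivity) hδ),
    tendsto_log_log.eventually (eventually_ge_atTop (Real.exp 1)),
    Real.tendsto_log_atTop.eventually (eventually_ge_atTop 2),
    eventually_gt_atTop 1] with x hx1 hx2 hx3 hx4 hx5 k hk hkx
  unfold logRatio
  set y := Real.log x with hy
  set t := Real.log y with ht
  have hy0 : 0 < y := by linarith
  have ht0 : 0 < t := (Real.exp_pos 1).trans_le hx3
  have hl1 : 1 ≤ Real.log t := by
    rw [← Real.log_exp 1]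
    exact Real.log_le_log (Real.exp_pos 1) hx3
  have hlt : Real.log t / t ≤ 1 / 2 := by
    rw [div_le_iff₀ ht0]
    have h1 := Real.log_le_sub_one_of_pos (show 0 < t / 2 by linarith)
    rw [Real.log_div ht0.ne' two_ne_zero] at h1
    have := Real.log_two_lt_d9
    linarith
  have hyt : y = Real.exp t := (Real.exp_log hy0).symm
  set ρ := (1 / 2 - δ) * (Real.log t / t) with hρ
  have hρ0 : 0 < ρ := by positivity
  have hρ1 : ρ ≤ 1 / 4 := by
    calc ρ ≤ 1 / 2 * (1 / 2) := by
          apply mul_le_mul (by linarith) hlt (by positivity) (by norm_num)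
      _ = 1 / 4 := by norm_num
  have hkx' : Real.log k ≤ y := Real.log_le_log (by exact_mod_cast hk) hkx
  have hdiv := sum_divisors_rpow_le hk.ne' hx4 hkx' (show 0 ≤ 2 * ρ by linarith) (by linarith)
  have hyρ : y ^ (2 * ρ) = t ^ (1 - 2 * δ) := by
    rw [hyt, ← Real.exp_mul, Real.rpow_def_of_pos ht0, hρ]
    congr 1
    field_simp
  rw [hyρ] at hdiv
  have hdiv2 : ∑ d ∈ k.divisors, (d : ℝ) ^ (-(1 - 2 * ρ)) ≤ Real.exp (t / 2) :=
    hdiv.trans (Real.exp_le_exp.2 hx1)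
  have hρinv : (A + 4) / ρ ≤ (A + 4) / (1 / 2 - δ) * t := by
    rw [hρ, ← div_div, div_div_eq_mul_div]
    exact div_le_self (by positivity) hl1
  refine (sum_divisors_rpow_neg_le (by linarith) _).trans ?_
  rw [Real.rpow_def_of_pos (by linarith), Real.exp_le_exp, ← hy]
  calc 4 * ∑ p ∈ (lucasSeq a b k).natAbs.primeFactors, (p : ℝ) ^ (-(1 - ρ))
      ≤ 4 * (N + (A + 4) / ρ * ∑ d ∈ k.divisors, (d : ℝ) ^ (-(1 - 2 * ρ))) := by
        gcongr
        exact sum_primeFactors_lucasSeq_rpow_le h hA hρ0 (by linarith) hk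
    _ ≤ 4 * (N + (A + 4) / (1 / 2 - δ) * t * Real.exp (t / 2)) := by
        gcongr
    _ = 4 * N + 4 * ((A + 4) / (1 / 2 - δ)) * t * Real.exp (t / 2) := by ring
    _ ≤ δ * (Real.exp t / t) := hx2
    _ ≤ δ * (Real.exp t / t) * Real.log t := le_mul_of_one_le_right (by positivity) hl1
    _ = y * (δ * (Real.log t / t)) := by rw [← hyt]; ring

end Uniform

/-! ### Integers with prescribed large prime factors -/

section Count

open Finset Filter Topology

theorem card_primeFactors_le_add {d M : ℕ} (hd : 0 < d) (hM : 2 ≤ M) :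
    (#d.primeFactors : ℝ) ≤ M + Real.log d / Real.log M := by
  have hlogM : 0 < Real.log M := Real.log_pos (by exact_mod_cast hM)
  have h1 : M ^ #(d.primeFactors.filter fun p => ¬ p < M) ≤ d := by
    calc M ^ #(d.primeFactors.filter fun p => ¬ p < M)
        = ∏ p ∈ d.primeFactors with ¬ p < M, M := by rw [prod_const]
      _ ≤ ∏ p ∈ d.primeFactors with ¬ p < M, p :=
          prod_le_prod' fun p hp => not_lt.1 (mem_filter.1 hp).2
      _ ≤ ∏ p ∈ d.primeFactors, p :=
          prod_le_prod_of_subset_of_one_le' (filter_subset _ _) fun p hp _ =>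
            (Nat.prime_of_mem_primeFactors hp).one_lt.le
      _ ≤ d := Nat.le_of_dvd hd (Nat.prod_primeFactors_dvd d)
  have h2 : Real.log ((M : ℝ) ^ #(d.primeFactors.filter fun p => ¬ p < M)) ≤ Real.log d :=
    Real.log_le_log (by positivity) (by exact_mod_cast h1)
  rw [Real.log_pow, ← le_div_iff₀ hlogM] at h2
  have h3 : #(d.primeFactors.filter fun p => p < M) ≤ M := by
    calc _ ≤ #(range M) := card_le_card fun p hp => mem_range.2 (mem_filter.1 hp).2
      _ = M := card_range M
  have h4 : ((#(d.primeFactors.filter fun p => p < M) : ℕ) : ℝ) ≤ M := by exact_mod_cast h3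
  rw [← card_filter_add_card_filter_not (s := d.primeFactors) (fun p => p < M)]
  push_cast
  linarith

/-- There are few integers up to `x` whose prime factors beyond `B` all divide a given
`d₀ ≤ x`. -/
theorem eventually_card_primes_dvd_le (B : ℕ) {δ : ℝ} (hδ : 0 < δ) :
    ∀ᶠ x : ℝ in atTop, ∀ d₀ : ℕ, 0 < d₀ → (d₀ : ℝ) ≤ x → ∀ s : Finset ℕ,
      (∀ d ∈ s, 0 < d ∧ (d : ℝ) ≤ x ∧ ∀ q : ℕ, q.Prime → B < q → q ∣ d → q ∣ d₀) →
      (#s : ℝ) ≤ x ^ δ := by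
  set A : ℝ := (1 - (2 : ℝ) ^ (-(δ / 2)))⁻¹ with hA
  have h2 : (2 : ℝ) ^ (-(δ / 2)) < 1 :=
    Real.rpow_lt_one_of_one_lt_of_neg one_lt_two (by linarith)
  have h2' : 0 < (2 : ℝ) ^ (-(δ / 2)) := Real.rpow_pos_of_pos two_pos _
  have hA1 : 1 ≤ A := (one_le_inv₀ (by linarith)).2 (by linarith)
  obtain ⟨M, hM2, hM⟩ : ∃ M : ℕ, 2 ≤ M ∧ 4 * Real.log A / δ ≤ Real.log M := by
    have := (Real.tendsto_log_atTop.comp tendsto_natCast_atTop_atTop).eventually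
      (eventually_ge_atTop (4 * Real.log A / δ))
    obtain ⟨M, h1, h2⟩ := (this.and (eventually_ge_atTop 2)).exists
    exact ⟨M, h2, h1⟩
  have hlogM : 0 < Real.log M := Real.log_pos (by exact_mod_cast hM2)
  have hlogA : 0 ≤ Real.log A := Real.log_nonneg hA1
  filter_upwards [eventually_gt_atTop 1, Real.tendsto_log_atTop.eventually
    (eventually_ge_atTop (4 * ((M + B + 1) * Real.log A) / δ))] with x hx1 hx2 d₀ hd₀ hd₀x s hs
  have hx0 : 0 < x := by linarith
  set P := d₀.primeFactors ∪ (range (B + 1)).filter Nat.Prime with hP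
  have hPprime : ∀ p ∈ P, p.Prime := by
    intro p hp
    rcases mem_union.1 hp with h | h
    · exact Nat.prime_of_mem_primeFactors h
    · exact (mem_filter.1 h).2
  have hPcard : (#P : ℝ) ≤ M + B + 1 + Real.log x / Real.log M := by
    have h1 : (#P : ℝ) ≤ #d₀.primeFactors + (B + 1 : ℕ) := by
      have : #P ≤ #d₀.primeFactors + (B + 1) := by
        refine (card_union_le _ _).trans (Nat.add_le_add_left ?_ _)
        exact (card_filter_le _ _).trans (card_range _).le
      exact_mod_cast this
    have h3 := card_primeFactors_le_add hd₀ hM2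
    have h4 : Real.log d₀ / Real.log M ≤ Real.log x / Real.log M := by
      gcongr
    push_cast at h1
    linarith
  have hsum := sum_rpow_neg_le_prod (half_pos hδ) s P hPprime fun d hd => by
    obtain ⟨hd0, -, hdq⟩ := hs d hd
    refine ⟨hd0.ne', fun q hq => ?_⟩
    have hqp := Nat.prime_of_mem_primeFactors hq
    rcases Nat.lt_or_ge B q with hB | hB
    · exact mem_union_left _ (Nat.mem_primeFactors.2
        ⟨hqp, hdq q hqp hB (Nat.dvd_of_mem_primeFactors hq), hd₀.ne'⟩)
    · exact mem_union_right _ (mem_filter.2 ⟨mem_range.2 (by omega), hqp⟩)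
  have hprod : ∏ p ∈ P, (1 - (p : ℝ) ^ (-(δ / 2)))⁻¹ ≤ x ^ (δ / 2) := by
    calc ∏ p ∈ P, (1 - (p : ℝ) ^ (-(δ / 2)))⁻¹ ≤ ∏ p ∈ P, A := by
          have hle : ∀ p ∈ P, (p : ℝ) ^ (-(δ / 2)) ≤ (2 : ℝ) ^ (-(δ / 2)) := fun p hp =>
            Real.rpow_le_rpow_of_nonpos two_pos (by exact_mod_cast (hPprime p hp).two_le)
              (by linarith)
          refine prod_le_prod (fun p hp => inv_nonneg.2 ?_) fun p hp => ?_
          · linarith [hle p hp]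
          · exact inv_anti₀ (by linarith) (by linarith [hle p hp])
      _ = Real.exp (#P * Real.log A) := by
          rw [prod_const, mul_comm, Real.exp_mul, Real.exp_log (by linarith), Real.rpow_natCast]
      _ ≤ Real.exp (Real.log x * (δ / 2)) := by
          refine Real.exp_le_exp.2 ?_
          have e1 : (M + B + 1) * Real.log A ≤ Real.log x * (δ / 4) := by
            rw [div_le_iff₀ hδ] at hx2
            linarith
          have e2 : Real.log x / Real.log M * Real.log A ≤ Real.log x * (δ / 4) := by
            rw [div_mul_eq_mul_div, mul_div_assoc]
            refine mul_le_mul_of_nonneg_left ?_ (Real.log_nonneg hx1.le)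
            rw [div_le_iff₀ hδ] at hM
            rw [div_le_iff₀ hlogM]
            linarith
          have e3 := mul_le_mul_of_nonneg_right hPcard hlogA
          linarith
      _ = x ^ (δ / 2) := (Real.rpow_def_of_pos hx0 _).symm
  calc (#s : ℝ) ≤ x ^ (δ / 2) * ∑ n ∈ s, (n : ℝ) ^ (-(δ / 2)) :=
        card_le_rpow_mul_sum (half_pos hδ).le s fun d hd => ⟨(hs d hd).1, (hs d hd).2.1⟩
    _ ≤ x ^ (δ / 2) * x ^ (δ / 2) := by
        gcongr
        exact hsum.trans hprod
    _ = x ^ δ := by rw [← Real.rpow_add hx0, add_halves]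

end Count

/-! ### The sum of `gcd (n, u n)` -/

section GcdSum

open Finset Filter Topology

variable {a b : ℤ}

/-- `gcd (n, u n)` for the Lucas sequence `u`. -/
def lucasGcd (a b : ℤ) (n : ℕ) : ℕ := Int.gcd (n : ℤ) (lucasSeq a b n)

theorem lucasGcd_pos {n : ℕ} (hn : 0 < n) : 0 < lucasGcd a b n :=
  Int.gcd_pos_of_ne_zero_left _ (by exact_mod_cast hn.ne')

theorem lucasGcd_dvd (n : ℕ) : lucasGcd a b n ∣ n :=
  Int.natCast_dvd_natCast.1 (Int.gcd_dvd_left _ _)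

theorem lucasGcd_dvd_lucasSeq (n : ℕ) : (lucasGcd a b n : ℤ) ∣ lucasSeq a b n :=
  Int.gcd_dvd_right _ _

theorem lucasGcd_mul_div (n : ℕ) : lucasGcd a b n * (n / lucasGcd a b n) = n :=
  Nat.mul_div_cancel' (lucasGcd_dvd n)

/-- The rank of appearance of `gcd (n, u n)`. -/
noncomputable def rankOfGcd (a b : ℤ) (n : ℕ) : ℕ := lucasRank a b (lucasGcd a b n)

theorem rankOfGcd_pos {n : ℕ} (hn : 0 < n) : 0 < rankOfGcd a b n :=
  (lucasRank_spec hn (lucasGcd_dvd_lucasSeq n)).1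

theorem rankOfGcd_dvd (hab : IsCoprime a b) {n : ℕ} (hn : 0 < n) : rankOfGcd a b n ∣ n :=
  (dvd_lucasSeq_iff hab (rankOfGcd_pos hn)).1 (lucasGcd_dvd_lucasSeq n)

theorem rankOfGcd_mul_div (hab : IsCoprime a b) {n : ℕ} (hn : 0 < n) :
    rankOfGcd a b n * (n / rankOfGcd a b n) = n :=
  Nat.mul_div_cancel' (rankOfGcd_dvd hab hn)

theorem lucasGcd_cast_eq {n : ℕ} (hn : 0 < n) :
    (lucasGcd a b n : ℝ) = n / ((n / lucasGcd a b n : ℕ) : ℝ) := by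
  rw [Nat.cast_div (lucasGcd_dvd n) (by exact_mod_cast (lucasGcd_pos hn).ne')]
  have h1 : (lucasGcd a b n : ℝ) ≠ 0 := by exact_mod_cast (lucasGcd_pos hn).ne'
  have h2 : (n : ℝ) ≠ 0 := by exact_mod_cast hn.ne'
  field_simp

theorem sum_lucasGcd_le_of_le_cofactor {x L : ℝ} (hx : 0 ≤ x) (hL : 0 < L) (s : Finset ℕ)
    (hs : ∀ n ∈ s, 0 < n ∧ (n : ℝ) ≤ x ∧ L ≤ ((n / lucasGcd a b n : ℕ) : ℝ)) :
    ∑ n ∈ s, (lucasGcd a b n : ℝ) ≤ x * (x / L) := by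
  have hcard : (#s : ℝ) ≤ x := by
    have : #s ≤ ⌊x⌋₊ := by
      calc #s ≤ #(Ioc 0 ⌊x⌋₊) := card_le_card fun n hn =>
            mem_Ioc.2 ⟨(hs n hn).1, Nat.le_floor (hs n hn).2.1⟩
        _ = ⌊x⌋₊ := by simp
    exact (Nat.cast_le.2 this).trans (Nat.floor_le hx)
  calc ∑ n ∈ s, (lucasGcd a b n : ℝ) ≤ ∑ n ∈ s, x / L := by
        refine sum_le_sum fun n hn => ?_
        obtain ⟨h1, h2, h3⟩ := hs n hn
        rw [lucasGcd_cast_eq h1]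
        gcongr
    _ = #s * (x / L) := by rw [sum_const, nsmul_eq_mul]
    _ ≤ x * (x / L) := by gcongr

/-- When both cofactors `n / gcd (n, u n)` and `n / z` are bounded, `z` being the rank of
`gcd (n, u n)`, the two cofactors almost determine `n`. -/
theorem eventually_card_small_cofactors_le (h : IsNondegenerateLucas a b) {δ : ℝ} (hδ : 0 < δ) :
    ∀ᶠ x : ℝ in atTop, ∀ L K : ℝ, 0 ≤ L → 0 ≤ K → ∀ s : Finset ℕ,
      (∀ n ∈ s, 0 < n ∧ (n : ℝ) ≤ x ∧ ((n / lucasGcd a b n : ℕ) : ℝ) ≤ L ∧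
        ((n / rankOfGcd a b n : ℕ) : ℝ) ≤ K) →
      (#s : ℝ) ≤ L * K * x ^ δ := by
  filter_upwards [eventually_card_primes_dvd_le (lucasExceptionalBound a b) hδ,
    eventually_gt_atTop 0] with x hx hx0 L K hL hK s hs
  have hmaps : ∀ n ∈ s, (n / lucasGcd a b n, n / rankOfGcd a b n) ∈
      Ioc 0 ⌊L⌋₊ ×ˢ Ioc 0 ⌊K⌋₊ := by
    intro n hn
    obtain ⟨h1, -, h3, h4⟩ := hs n hn
    simp only [mem_product, mem_Ioc]
    exact ⟨⟨Nat.div_pos (Nat.le_of_dvd h1 (lucasGcd_dvd n)) (lucasGcd_pos h1), Nat.le_floor h3⟩,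
      Nat.div_pos (Nat.le_of_dvd h1 (rankOfGcd_dvd h.coprime h1)) (rankOfGcd_pos h1),
      Nat.le_floor h4⟩
  have hfib : ∀ c ∈ Ioc 0 ⌊L⌋₊ ×ˢ Ioc 0 ⌊K⌋₊,
      ((#(s.filter fun n => (n / lucasGcd a b n, n / rankOfGcd a b n) = c) : ℕ) : ℝ) ≤ x ^ δ := by
    rintro ⟨m, w⟩ hc
    set F := s.filter fun n => (n / lucasGcd a b n, n / rankOfGcd a b n) = (m, w) with hF
    have hFmem : ∀ n ∈ F, n ∈ s ∧ lucasGcd a b n * m = n ∧ rankOfGcd a b n * w = n := by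
      intro n hn
      obtain ⟨hns, hn2⟩ := mem_filter.1 hn
      rw [Prod.mk.injEq] at hn2
      refine ⟨hns, ?_, ?_⟩
      · rw [← hn2.1, lucasGcd_mul_div]
      · rw [← hn2.2, rankOfGcd_mul_div h.coprime (hs n hns).1]
    rcases F.eq_empty_or_nonempty with he | ⟨n₀, hn₀⟩
    · rw [he, card_empty, Nat.cast_zero]
      positivity
    have hinj : Set.InjOn (lucasGcd a b) F := by
      intro n hn n' hn' hnn
      rw [← (hFmem n hn).2.1, hnn, (hFmem n' hn').2.1]
    rw [← card_image_of_injOn hinj]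
    have hle : ∀ n ∈ s, (lucasGcd a b n : ℝ) ≤ x := fun n hn =>
      le_trans (by exact_mod_cast Nat.le_of_dvd (hs n hn).1 (lucasGcd_dvd n)) (hs n hn).2.1
    obtain ⟨hn₀s, hm₀, hw₀⟩ := hFmem n₀ hn₀
    have hn₀pos := (hs n₀ hn₀s).1
    refine hx (lucasGcd a b n₀) (lucasGcd_pos hn₀pos) (hle n₀ hn₀s) _ fun d hd => ?_
    obtain ⟨n, hn, rfl⟩ := mem_image.1 hd
    obtain ⟨hns, hm, hw⟩ := hFmem n hn
    have hnpos := (hs n hns).1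
    refine ⟨lucasGcd_pos hnpos, hle n hns, fun q hq hqB hqd => ?_⟩
    have hmpos : 0 < m := (mem_Ioc.1 (mem_product.1 hc).1).1
    refine prime_dvd_of_mul_lucasRank_eq h (w := w) hmpos (lucasGcd_pos hn₀pos)
      (lucasGcd_pos hnpos) (rankOfGcd_pos hn₀pos) (rankOfGcd_pos hnpos) ?_ ?_ hq hqB hqd
    · rw [mul_comm m, hm₀, mul_comm]
      exact hw₀
    · rw [mul_comm m, hm, mul_comm]
      exact hw
  rw [card_eq_sum_card_fiberwise hmaps, Nat.cast_sum]
  calc _ ≤ ∑ c ∈ Ioc 0 ⌊L⌋₊ ×ˢ Ioc 0 ⌊K⌋₊, x ^ δ := sum_le_sum hfib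
    _ = (⌊L⌋₊ : ℝ) * ⌊K⌋₊ * x ^ δ := by
        rw [sum_const, nsmul_eq_mul, card_product]
        simp
    _ ≤ L * K * x ^ δ := by
        gcongr
        · exact Nat.floor_le hL
        · exact Nat.floor_le hK

/-- For given rank `k` and cofactor `m`, the number `gcd (n, u n)` is `k / gcd (k, m)` times a
divisor of `u k` not exceeding `x / k`. -/
theorem card_rank_cofactor_le (h : IsNondegenerateLucas a b) {x c : ℝ} (hx : 0 ≤ x)
    (hc : 0 ≤ c) {k m : ℕ} (hk : 0 < k) (s : Finset ℕ)
    (hs : ∀ n ∈ s, 0 < n ∧ (n : ℝ) ≤ x ∧ n / lucasGcd a b n = m ∧ rankOfGcd a b n = k) :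
    (#s : ℝ) ≤ (x / k) ^ c * ∑ f ∈ (lucasSeq a b k).natAbs.divisors, (f : ℝ) ^ (-c) := by
  have hg : 0 < Nat.gcd k m := Nat.gcd_pos_of_pos_left m hk
  set r := k / Nat.gcd k m with hr
  have hrk : r * Nat.gcd k m = k := Nat.div_mul_cancel (Nat.gcd_dvd_left k m)
  have hrpos : 0 < r := Nat.div_pos (Nat.le_of_dvd hk (Nat.gcd_dvd_left k m)) hg
  have hfac : ∀ n ∈ s, lucasGcd a b n * m = n ∧ r * (lucasGcd a b n / r) = lucasGcd a b n := by
    intro n hn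
    obtain ⟨h1, -, h3, h4⟩ := hs n hn
    have e1 : lucasGcd a b n * m = n := by rw [← h3, lucasGcd_mul_div]
    refine ⟨e1, Nat.mul_div_cancel' ?_⟩
    have e2 : k ∣ lucasGcd a b n * m := by
      rw [e1, ← h4]
      exact rankOfGcd_dvd h.coprime h1
    have e3 : r * Nat.gcd k m ∣ lucasGcd a b n * (m / Nat.gcd k m) * Nat.gcd k m := by
      rw [hrk, mul_assoc, Nat.div_mul_cancel (Nat.gcd_dvd_right k m)]
      exact e2
    exact (Nat.coprime_div_gcd_div_gcd hg).dvd_of_dvd_mul_right (Nat.dvd_of_mul_dvd_mul_right hg e3)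
  have hinj : Set.InjOn (fun n => lucasGcd a b n / r) s := by
    intro n hn n' hn' hnn
    simp only at hnn
    rw [← (hfac n hn).1, ← (hfac n hn).2, hnn, (hfac n' hn').2, (hfac n' hn').1]
  have hk' : (0 : ℝ) < k := by exact_mod_cast hk
  rw [← card_image_of_injOn hinj]
  have hmem : ∀ f ∈ s.image (fun n => lucasGcd a b n / r),
      0 < f ∧ (f : ℝ) ≤ x / k ∧ f ∈ (lucasSeq a b k).natAbs.divisors := by
    intro f hf
    obtain ⟨n, hn, rfl⟩ := mem_image.1 hf
    obtain ⟨h1, h2, h3, h4⟩ := hs n hn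
    obtain ⟨e1, e2⟩ := hfac n hn
    refine ⟨?_, ?_, ?_⟩
    · refine Nat.pos_of_ne_zero fun h0 => ?_
      rw [h0, mul_zero] at e2
      exact (lucasGcd_pos h1).ne e2
    · rw [le_div_iff₀ hk']
      refine le_trans ?_ h2
      have hmpos : 0 < m := Nat.pos_of_ne_zero fun h0 => by
        rw [h0, mul_zero] at e1
        exact h1.ne e1
      have : lucasGcd a b n / r * k ≤ n := by
        calc lucasGcd a b n / r * k = r * (lucasGcd a b n / r) * Nat.gcd k m := by
              nth_rewrite 1 [← hrk]
              ring
          _ ≤ lucasGcd a b n * m := by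
              rw [e2]
              exact Nat.mul_le_mul_left _ (Nat.le_of_dvd hmpos (Nat.gcd_dvd_right k m))
          _ = n := e1
      exact_mod_cast this
    · refine Nat.mem_divisors.2 ⟨?_, Int.natAbs_ne_zero.2 (h.lucasSeq_ne_zero hk)⟩
      refine (Dvd.intro_left _ e2).trans (Int.natCast_dvd.1 ?_)
      have hz : 0 < lucasRank a b (lucasGcd a b n) := rankOfGcd_pos h1
      exact (dvd_lucasSeq_iff h.coprime hz).2 (Dvd.intro 1 (by rw [mul_one]; exact h4))
  refine (card_le_rpow_mul_sum hc _ fun f hf => ⟨(hmem f hf).1, (hmem f hf).2.1⟩).trans ?_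
  gcongr
  exact fun f hf => (hmem f hf).2.2

theorem sum_Icc_one_div_le {x : ℝ} (hx : 1 ≤ x) :
    ∑ m ∈ Icc 1 ⌊x⌋₊, (1 / m : ℝ) ≤ 1 + Real.log x := by
  have h1 := harmonic_floor_le_one_add_log x hx
  rw [harmonic_eq_sum_Icc] at h1
  push_cast at h1
  simpa only [one_div] using h1

theorem sum_lucasGcd_le_of_rank_small (h : IsNondegenerateLucas a b) {x K ρ E : ℝ} (hx : 1 ≤ x)
    (hK : 1 ≤ K) (hρ0 : 0 < ρ) (hρ1 : ρ ≤ 1) (hE0 : 0 ≤ E)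
    (hE : ∀ k : ℕ, 0 < k → (k : ℝ) ≤ x →
      ∑ f ∈ (lucasSeq a b k).natAbs.divisors, (f : ℝ) ^ (-(1 - ρ)) ≤ E) (s : Finset ℕ)
    (hs : ∀ n ∈ s, 0 < n ∧ (n : ℝ) ≤ x ∧ K ≤ ((n / rankOfGcd a b n : ℕ) : ℝ)) :
    ∑ n ∈ s, (lucasGcd a b n : ℝ) ≤ x ^ 2 * ((1 + Real.log x) / ρ) * E * K ^ (-ρ) := by
  have hx0 : 0 < x := by linarith
  have hK0 : 0 < K := by linarith
  have hmaps : ∀ n ∈ s, (n / lucasGcd a b n, rankOfGcd a b n) ∈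
      Icc 1 ⌊x⌋₊ ×ˢ Icc 1 ⌊x / K⌋₊ := by
    intro n hn
    obtain ⟨h1, h2, h3⟩ := hs n hn
    simp only [mem_product, mem_Icc]
    refine ⟨⟨Nat.div_pos (Nat.le_of_dvd h1 (lucasGcd_dvd n)) (lucasGcd_pos h1),
      (Nat.div_le_self _ _).trans (Nat.le_floor h2)⟩, rankOfGcd_pos h1, Nat.le_floor ?_⟩
    rw [le_div_iff₀ hK0]
    calc (rankOfGcd a b n : ℝ) * K ≤ rankOfGcd a b n * ((n / rankOfGcd a b n : ℕ) : ℝ) := by gcongr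
      _ = n := by exact_mod_cast rankOfGcd_mul_div h.coprime h1
      _ ≤ x := h2
  rw [← sum_fiberwise_of_maps_to hmaps]
  calc _ ≤ ∑ c ∈ Icc 1 ⌊x⌋₊ ×ˢ Icc 1 ⌊x / K⌋₊,
          x * (1 / c.1 : ℝ) * ((x / c.2) ^ (1 - ρ) * E) := by
        refine sum_le_sum ?_
        rintro ⟨m, k⟩ hc
        simp only [mem_product, mem_Icc] at hc
        obtain ⟨⟨hm1, -⟩, hk1, hk2⟩ := hc
        have hm0 : (0 : ℝ) < m := by exact_mod_cast hm1
        have hk0 : (0 : ℝ) < k := by exact_mod_cast hk1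
        have hkx : (k : ℝ) ≤ x := by
          calc (k : ℝ) ≤ x / K := (Nat.le_floor_iff (by positivity)).1 hk2
            _ ≤ x := div_le_self hx0.le hK
        set F := s.filter fun n => (n / lucasGcd a b n, rankOfGcd a b n) = (m, k) with hF
        have hFmem : ∀ n ∈ F, 0 < n ∧ (n : ℝ) ≤ x ∧ n / lucasGcd a b n = m ∧
            rankOfGcd a b n = k := by
          intro n hn
          obtain ⟨hns, hn2⟩ := mem_filter.1 hn
          rw [Prod.mk.injEq] at hn2
          exact ⟨(hs n hns).1, (hs n hns).2.1, hn2.1, hn2.2⟩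
        calc ∑ n ∈ F, (lucasGcd a b n : ℝ) ≤ ∑ n ∈ F, x * (1 / m : ℝ) := by
              refine sum_le_sum fun n hn => ?_
              obtain ⟨h1, h2, h3, -⟩ := hFmem n hn
              rw [lucasGcd_cast_eq h1, h3, mul_one_div]
              gcongr
          _ = x * (1 / m : ℝ) * #F := by rw [sum_const, nsmul_eq_mul, mul_comm]
          _ ≤ x * (1 / m : ℝ) * ((x / k) ^ (1 - ρ) * E) := by
              gcongr
              refine (card_rank_cofactor_le h hx0.le (by linarith : 0 ≤ 1 - ρ) hk1 F hFmem).trans ?_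
              gcongr
              exact hE k hk1 hkx
    _ = x * (∑ m ∈ Icc 1 ⌊x⌋₊, (1 / m : ℝ)) *
          (x ^ (1 - ρ) * (∑ k ∈ Icc 1 ⌊x / K⌋₊, (k : ℝ) ^ (ρ - 1)) * E) := by
        rw [sum_product, mul_sum, mul_sum, sum_mul]
        refine sum_congr rfl fun m _ => ?_
        rw [sum_mul, mul_sum]
        refine sum_congr rfl fun k _ => ?_
        rw [Real.div_rpow hx0.le k.cast_nonneg, div_eq_mul_inv (x ^ (1 - ρ)),
          ← Real.rpow_neg k.cast_nonneg, neg_sub]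
    _ ≤ x * (1 + Real.log x) * (x ^ (1 - ρ) * ((x / K) ^ ρ / ρ) * E) := by
        have h1 : (∑ k ∈ Icc 1 ⌊x / K⌋₊, (k : ℝ) ^ (ρ - 1)) ≤ (x / K) ^ ρ / ρ := by
          refine (sum_Icc_rpow_le hρ0 hρ1 _).trans ?_
          gcongr
          exact Nat.floor_le (by positivity)
        have hl : 0 ≤ 1 + Real.log x := by linarith [Real.log_nonneg hx]
        gcongr
        exact sum_Icc_one_div_le hx
    _ = x ^ 2 * ((1 + Real.log x) / ρ) * E * K ^ (-ρ) := by
        rw [Real.div_rpow hx0.le hK0.le, Real.rpow_neg hK0.le, Real.rpow_sub hx0, Real.rpow_one]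
        have := Real.rpow_pos_of_pos hx0 ρ
        field_simp

theorem tendsto_logRatio : Tendsto logRatio atTop (𝓝 0) := by
  have h1 : Tendsto (fun t : ℝ => Real.log t / t) atTop (𝓝 0) :=
    Real.isLittleO_log_id_atTop.tendsto_div_nhds_zero
  exact h1.comp tendsto_log_log

theorem eventually_logRatio_pos : ∀ᶠ x : ℝ in atTop, 0 < logRatio x := by
  filter_upwards [tendsto_log_log.eventually (eventually_gt_atTop 1)] with x hx
  exact div_pos (Real.log_pos hx) (by linarith)

theorem eventually_log_factor_le {δ : ℝ} (hδ : 0 < δ) (hδ' : δ < 1 / 2) :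
    ∀ᶠ x : ℝ in atTop,
      3 * ((1 + Real.log x) / ((1 / 2 - δ) * logRatio x)) ≤ x ^ (δ * logRatio x) := by
  have hhalf : 0 < 1 / 2 - δ := by linarith
  have hD : 0 ≤ Real.log (6 / (1 / 2 - δ)) :=
    Real.log_nonneg ((one_le_div hhalf).2 (by linarith))
  filter_upwards [tendsto_log_log.eventually
      (eventually_mul_exp_half_le 2 (Real.log (6 / (1 / 2 - δ))) (by norm_num) hD hδ),
    tendsto_log_log.eventually (eventually_ge_atTop (Real.exp 1)),
    Real.tendsto_log_atTop.eventually (eventually_ge_atTop 1),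
    eventually_gt_atTop 1] with x hx1 hx2 hx3 hx4
  unfold logRatio
  rw [Real.rpow_def_of_pos (by linarith)]
  set y := Real.log x with hy
  set t := Real.log y with ht
  have hy0 : 0 < y := by linarith
  have ht0 : 0 < t := (Real.exp_pos 1).trans_le hx2
  have hl1 : 1 ≤ Real.log t := by
    rw [← Real.log_exp 1]
    exact Real.log_le_log (Real.exp_pos 1) hx2
  have hyt : y = Real.exp t := (Real.exp_log hy0).symm
  calc 3 * ((1 + y) / ((1 / 2 - δ) * (Real.log t / t)))
      = 3 * ((1 + y) * t / (1 / 2 - δ)) / Real.log t := by field_simp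
    _ ≤ 3 * ((1 + y) * t / (1 / 2 - δ)) := div_le_self (by positivity) hl1
    _ ≤ 3 * ((y + y) * t / (1 / 2 - δ)) := by gcongr
    _ = 6 / (1 / 2 - δ) * Real.exp t * t := by rw [← hyt]; ring
    _ = Real.exp (Real.log (6 / (1 / 2 - δ)) + t + Real.log t) := by
        rw [Real.exp_add, Real.exp_add,
          Real.exp_log (show 0 < 6 / (1 / 2 - δ) by positivity), Real.exp_log ht0]
    _ ≤ Real.exp (y * (δ * (Real.log t / t))) := by
        refine Real.exp_le_exp.2 ?_
        have h1 : Real.log t ≤ t := (Real.log_le_sub_one_of_pos ht0).trans (by linarith)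
        have h2 : 1 ≤ Real.exp (t / 2) := Real.one_le_exp (by linarith)
        have h3 : t * 1 ≤ t * Real.exp (t / 2) := by gcongr
        calc Real.log (6 / (1 / 2 - δ)) + t + Real.log t
            ≤ Real.log (6 / (1 / 2 - δ)) + 2 * t * Real.exp (t / 2) := by linarith
          _ ≤ δ * (Real.exp t / t) := hx1
          _ ≤ δ * (Real.exp t / t) * Real.log t := le_mul_of_one_le_right (by positivity) hl1
          _ = y * (δ * (Real.log t / t)) := by rw [← hyt]; ring

/-- The sum of `gcd (n, u n)` over `n ≤ x`. -/
noncomputable def lucasGcdSum (a b : ℤ) (x : ℝ) : ℝ :=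
  ∑ n ∈ Ioc 0 ⌊x⌋₊, (lucasGcd a b n : ℝ)

theorem eventually_lucasGcdSum_le (h : IsNondegenerateLucas a b) {δ : ℝ} (hδ : 0 < δ)
    (hδ' : δ < 1 / 2) :
    ∀ᶠ x : ℝ in atTop, lucasGcdSum a b x ≤ x ^ (2 - (1 / 2 - 4 * δ) * logRatio x) := by
  filter_upwards [eventually_card_small_cofactors_le h (show 0 < δ / 4 by linarith),
    eventually_sum_divisors_lucasSeq_le h hδ hδ', eventually_log_factor_le hδ hδ',
    eventually_logRatio_pos, tendsto_logRatio.eventually (eventually_lt_nhds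
      (show 0 < δ / 4 by linarith)), eventually_gt_atTop 1,
    (tendsto_rpow_atTop (show 0 < δ / 8 by linarith)).eventually (eventually_ge_atTop 3)]
    with x hx1 hx2 hx3 hr0 hr1 hx hx4
  set r := logRatio x with hr
  have hx0 : 0 < x := by linarith
  have hhalf : 0 < 1 / 2 - δ := by linarith
  -- thresholds for the cofactors `n / gcd (n, u n)` and `n / z`, where `z` is the rank of the gcd
  set L := x ^ (δ / 4) with hL
  set K := x ^ (1 - δ) with hK
  have hL0 : 0 < L := Real.rpow_pos_of_pos hx0 _
  have hK1 : 1 ≤ K := Real.one_le_rpow hx.le (by linarith)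
  set m : ℕ → ℝ := fun n => ((n / lucasGcd a b n : ℕ) : ℝ) with hm
  set w : ℕ → ℝ := fun n => ((n / rankOfGcd a b n : ℕ) : ℝ) with hw
  set s := Ioc 0 ⌊x⌋₊ with hs
  have hsmem : ∀ n ∈ s, 0 < n ∧ (n : ℝ) ≤ x := fun n hn =>
    ⟨(mem_Ioc.1 hn).1, (Nat.le_floor_iff hx0.le).1 (mem_Ioc.1 hn).2⟩
  -- large cofactor of the gcd
  have h1 : ∑ n ∈ s with L ≤ m n, (lucasGcd a b n : ℝ) ≤ x * (x / L) :=
    sum_lucasGcd_le_of_le_cofactor hx0.le hL0 _ fun n hn =>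
      ⟨(hsmem n (mem_filter.1 hn).1).1, (hsmem n (mem_filter.1 hn).1).2, (mem_filter.1 hn).2⟩
  -- both cofactors small
  have h2 : ∑ n ∈ s with m n ≤ L ∧ w n ≤ K, (lucasGcd a b n : ℝ) ≤
      L * K * x ^ (δ / 4) * x := by
    calc _ ≤ ∑ n ∈ s with m n ≤ L ∧ w n ≤ K, x := by
          refine sum_le_sum fun n hn => ?_
          obtain ⟨e1, e2⟩ := hsmem n (mem_filter.1 hn).1
          exact le_trans (by exact_mod_cast Nat.le_of_dvd e1 (lucasGcd_dvd n)) e2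
      _ = ((#(s.filter fun n => m n ≤ L ∧ w n ≤ K) : ℕ) : ℝ) * x := by
          rw [sum_const, nsmul_eq_mul]
      _ ≤ L * K * x ^ (δ / 4) * x := by
          gcongr
          refine hx1 L K hL0.le (by linarith) _ fun n hn => ?_
          obtain ⟨e1, e2, e3⟩ := mem_filter.1 hn
          exact ⟨(hsmem n e1).1, (hsmem n e1).2, e2, e3⟩
  -- small rank
  have h3 : ∑ n ∈ s with K ≤ w n, (lucasGcd a b n : ℝ) ≤
      x ^ 2 * ((1 + Real.log x) / ((1 / 2 - δ) * r)) * x ^ (δ * r) *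
        K ^ (-((1 / 2 - δ) * r)) := by
    refine sum_lucasGcd_le_of_rank_small h hx.le hK1 (by positivity) ?_ (by positivity) hx2 _
      fun n hn => ⟨(hsmem n (mem_filter.1 hn).1).1, (hsmem n (mem_filter.1 hn).1).2,
        (mem_filter.1 hn).2⟩
    nlinarith
  set T := x ^ (2 - (1 / 2 - 4 * δ) * r) with hT
  have hx2 : x = x ^ (1 : ℝ) := (Real.rpow_one x).symm
  have hmono : ∀ u v : ℝ, u ≤ v → x ^ u ≤ x ^ v := fun u v huv =>
    Real.rpow_le_rpow_of_exponent_le hx.le huv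
  have hthird : ∀ u : ℝ, u ≤ 2 - δ / 4 → 3 * x ^ u ≤ T := by
    intro u hu
    calc 3 * x ^ u ≤ x ^ (δ / 8) * x ^ u := by gcongr
      _ = x ^ (δ / 8 + u) := (Real.rpow_add hx0 _ _).symm
      _ ≤ T := hmono _ _ (by nlinarith)
  have g1 : 3 * (x * (x / L)) ≤ T := by
    have : x * (x / L) = x ^ (2 - δ / 4) := by
      rw [Real.rpow_sub hx0, Real.rpow_two]
      ring
    rw [this]
    exact hthird _ le_rfl
  have g2 : 3 * (L * K * x ^ (δ / 4) * x) ≤ T := by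
    have : L * K * x ^ (δ / 4) * x = x ^ (δ / 4 + (1 - δ) + δ / 4 + 1) := by
      rw [Real.rpow_add hx0, Real.rpow_add hx0, Real.rpow_add hx0, Real.rpow_one]
    rw [this]
    exact hthird _ (by linarith)
  have g3 : 3 * (x ^ 2 * ((1 + Real.log x) / ((1 / 2 - δ) * r)) * x ^ (δ * r) *
      K ^ (-((1 / 2 - δ) * r))) ≤ T := by
    calc 3 * (x ^ 2 * ((1 + Real.log x) / ((1 / 2 - δ) * r)) * x ^ (δ * r) *
          K ^ (-((1 / 2 - δ) * r)))
        = x ^ 2 * (3 * ((1 + Real.log x) / ((1 / 2 - δ) * r))) * x ^ (δ * r) *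
          K ^ (-((1 / 2 - δ) * r)) := by ring
      _ ≤ x ^ 2 * x ^ (δ * r) * x ^ (δ * r) * K ^ (-((1 / 2 - δ) * r)) := by gcongr
      _ = x ^ (2 + δ * r + δ * r + (1 - δ) * (-((1 / 2 - δ) * r))) := by
          rw [Real.rpow_add hx0, Real.rpow_add hx0, Real.rpow_add hx0, Real.rpow_two, hK,
            ← Real.rpow_mul hx0.le]
      _ ≤ T := hmono _ _ (by nlinarith [mul_pos hδ hr0, mul_pos (mul_pos hδ hδ) hr0])
  have hcover : s ⊆ (s.filter fun n => L ≤ m n) ∪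
      (s.filter fun n => m n ≤ L ∧ w n ≤ K) ∪ (s.filter fun n => K ≤ w n) := by
    intro n hn
    simp only [mem_union, mem_filter]
    rcases le_total L (m n) with e1 | e1
    · exact Or.inl (Or.inl ⟨hn, e1⟩)
    · rcases le_total (w n) K with e2 | e2
      · exact Or.inl (Or.inr ⟨hn, e1, e2⟩)
      · exact Or.inr ⟨hn, e2⟩
  have hnn : ∀ n : ℕ, 0 ≤ (lucasGcd a b n : ℝ) := fun n => Nat.cast_nonneg _
  calc lucasGcdSum a b x ≤ _ := sum_le_sum_of_subset_of_nonneg hcover fun n _ _ => hnn n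
    _ ≤ _ := sum_union_le_add hnn _ _
    _ ≤ _ := add_le_add_left (sum_union_le_add hnn _ _) _
    _ ≤ x * (x / L) + L * K * x ^ (δ / 4) * x + x ^ 2 * ((1 + Real.log x) / ((1 / 2 - δ) * r)) *
          x ^ (δ * r) * K ^ (-((1 / 2 - δ) * r)) := add_le_add (add_le_add h1 h2) h3
    _ ≤ T := by linarith

theorem one_le_lucasGcdSum {x : ℝ} (hx : 1 ≤ x) : 1 ≤ lucasGcdSum a b x := by
  have h1 : 1 ∈ Ioc 0 ⌊x⌋₊ := mem_Ioc.2 ⟨one_pos, Nat.le_floor (by simpa using hx)⟩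
  refine le_trans ?_ (single_le_sum (f := fun n => (lucasGcd a b n : ℝ))
    (fun n _ => Nat.cast_nonneg _) h1)
  exact_mod_cast lucasGcd_pos one_pos

theorem countGcdGt_mul_le {x y : ℝ} (hx : 0 ≤ x) :
    (countGcdGt (lucasSeq a b) x y : ℝ) * y ≤ lucasGcdSum a b x := by
  have hset : {n : ℕ | 0 < n ∧ (n : ℝ) ≤ x ∧ y < (Int.gcd (n : ℤ) (lucasSeq a b n) : ℝ)} =
      ((Ioc 0 ⌊x⌋₊).filter fun n => y < (lucasGcd a b n : ℝ) : Finset ℕ) := by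
    ext n
    rw [mem_coe, mem_filter, mem_Ioc, Nat.le_floor_iff hx, and_assoc]
    rfl
  rw [countGcdGt, hset, Set.ncard_coe_finset, ← nsmul_eq_mul, ← sum_const]
  calc _ ≤ ∑ n ∈ Ioc 0 ⌊x⌋₊ with y < (lucasGcd a b n : ℝ), (lucasGcd a b n : ℝ) :=
        sum_le_sum fun n hn => (mem_filter.1 hn).2.le
    _ ≤ lucasGcdSum a b x :=
        sum_le_sum_of_subset_of_nonneg (filter_subset _ _) fun n _ _ => Nat.cast_nonneg _

end GcdSum

theorem corollary1p6 (a₁ a₂ : ℤ) (h : IsNondegenerateLucas a₁ a₂) :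
    ∃ ε : ℝ → ℝ, Filter.Tendsto ε Filter.atTop (nhds 0) ∧
      ∀ᶠ x : ℝ in Filter.atTop, ∀ y : ℝ, 1 ≤ y →
        (countGcdGt (lucasSeq a₁ a₂) x y : ℝ) ≤
          x ^ (2 - (1 / 2 + ε x) *
            (Real.log (Real.log (Real.log x)) / Real.log (Real.log x))) / y := by
  -- `ε` is chosen to make the exponent exact, or zero when that choice would be positive
  refine ⟨fun x => min 0
    ((2 - Real.log (lucasGcdSum a₁ a₂ x) / Real.log x) / logRatio x - 1 / 2), ?_, ?_⟩
  · rw [Metric.tendsto_nhds]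
    intro η hη
    obtain ⟨δ, hδ0, hδ1, hδη⟩ : ∃ δ : ℝ, 0 < δ ∧ δ < 1 / 2 ∧ 4 * δ < η :=
      ⟨min (1 / 4) (η / 8), by positivity, by linarith [min_le_left (1 / 4 : ℝ) (η / 8)],
        by linarith [min_le_right (1 / 4 : ℝ) (η / 8)]⟩
    filter_upwards [eventually_lucasGcdSum_le h hδ0 hδ1, eventually_logRatio_pos,
      Filter.eventually_gt_atTop 1] with x hx1 hr hx
    have hlog : 0 < Real.log x := Real.log_pos hx
    have hS := one_le_lucasGcdSum (a := a₁) (b := a₂) hx.le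
    have h1 := Real.log_le_log (by linarith) hx1
    rw [Real.log_rpow (by linarith), ← div_le_iff₀ hlog] at h1
    have h2 : 1 / 2 - 4 * δ ≤
        (2 - Real.log (lucasGcdSum a₁ a₂ x) / Real.log x) / logRatio x := by
      rw [le_div_iff₀ hr]
      linarith
    rw [Real.dist_eq, sub_zero, abs_lt]
    refine ⟨lt_min (by linarith) (by linarith), lt_of_le_of_lt (min_le_left _ _) hη⟩
  · filter_upwards [eventually_logRatio_pos, Filter.eventually_gt_atTop 1] with x hr hx y hy
    have hlog : 0 < Real.log x := Real.log_pos hx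
    have hS := one_le_lucasGcdSum (a := a₁) (b := a₂) hx.le
    rw [le_div_iff₀ (by linarith)]
    refine (countGcdGt_mul_le (by linarith)).trans ?_
    change _ ≤ x ^ (2 - (1 / 2 + min 0
      ((2 - Real.log (lucasGcdSum a₁ a₂ x) / Real.log x) / logRatio x - 1 / 2)) * logRatio x)
    set e := min 0 ((2 - Real.log (lucasGcdSum a₁ a₂ x) / Real.log x) / logRatio x - 1 / 2)
    have he : (1 / 2 + e) * logRatio x ≤ 2 - Real.log (lucasGcdSum a₁ a₂ x) / Real.log x := by
      rw [← le_div_iff₀ hr]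
      linarith [min_le_right (0 : ℝ)
        ((2 - Real.log (lucasGcdSum a₁ a₂ x) / Real.log x) / logRatio x - 1 / 2)]
    rw [← Real.log_le_log_iff (by linarith) (Real.rpow_pos_of_pos (by linarith) _),
      Real.log_rpow (by linarith), ← div_le_iff₀ hlog]
    linarith
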